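/- **Notation.** Let $F(0)=1$, $F(1)=2$, $F(n+2)=F(n+1)+F(n)$, let $\mathrm{rep}_F(n)\in\{0,1\}^*$ be the Zeckendorf (greedy) representation of $n$ with respect to $F$, most significant digit first, with $\mathrm{rep}_F(0)=\varepsilon$, and let $\mathrm{val}_F(d_{\ell-1}\cdots d_0)=\sum_j d_jF(j)$. Let $s_F(n)$ be the number of words $v\in \mathrm{rep}_F(\mathbb N)$ that occur as scattered subwords of $\mathrm{rep}_F(n)$, i.e. with $\binom{\mathrm{rep}_F(n)}{v}>0$, and let $A_F(N)=\sum_{j=0}^N s_F(j)$. Let $\varphi$ be the golden ratio. If $\mathrm{rep}_F(n)=10r_1\cdots r_k$ with $k\ge 0$, let $\mathrm{relpos}_F(n)=\sum_{i=1}^k r_i\varphi^{-i}$ and $\log_F n=|\mathrm{rep}_F(n)|-1+\mathrm{relpos}_F(n)$; put also $\mathrm{relpos}_F(1)=\log_F 1=0$. Let $B(0)=1$, $B(1)=3$, $B(2)=6$, $B(n+3)=2B(n+2)+B(n+1)-B(n)$. For $n\ge3$ let $\ell=|\mathrm{rep}_F(n)|-1$ and let $b_0(n),\dots,b_\ell(n)$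 be the integer coefficients in $A_F(n)=\sum_{i=0}^{\ell}b_i(n)B(\ell-i)$ obtained by iterating, for $m=F(j)+r$ with $j\ge 2$ and $0\le r<F(j-1)$, the rules $A_F(m)=B(j)-B(j-1)+A_F(F(j-1)+r)+A_F(r)$ if $r<F(j-2)$ and $A_F(m)=2B(j)-B(j-1)-B(j-2)+2A_F(r)$ if $r\ge F(j-2)$, down to $A_F(0)=B(0)$, $A_F(1)=3B(0)$, $A_F(2)=6B(0)$. For $\alpha\in[0,1)$ let $d_1d_2\cdots$ be its $\varphi$-expansion, i.e. the sequence of non-negative integers with $\sum_{i\ge1}d_i\varphi^{-i}=\alpha$ and $\sum_{i\ge j}d_i\varphi^{-i}<\varphi^{-j+1}$ for all $j\ge1$. For $n\ge1$ let $e_n(\alpha)=\mathrm{val}_F(w_n(\alpha))$, where $w_n(\alpha)$ is the prefix of length $n$ of $10d_1d_2\cdots$. Let $b_i(\alpha)=\lim_{n\to\infty}b_i(e_n(\alpha))$. **Theorem.** The polynomial $X^3-2X^2-X+1$ has three real roots $\beta,\beta_2,\beta_3$ with $\beta>|\beta_2|,|\beta_3|$, and there are real constants $c>0$, $c_2$,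 $c_3$ with $B(n)=c\beta^n+c_2\beta_2^n+c_3\beta_3^n$ for all $n\ge0$. For every $\alpha\in[0,1)$ and $i\ge 0$ the sequence $(b_i(e_n(\alpha)))_n$ is eventually constant, and the series in $$\Psi(\alpha)=\frac1{\beta^\alpha}\sum_{i=0}^{\infty}\frac{b_i(\alpha)}{\beta^i}$$ converges absolutely. On $[0,1)$ the functions $\psi_n(\alpha)=\dfrac{A_F(e_n(\alpha))}{c\,\beta^{\log_F(e_n(\alpha))}}$ converge uniformly to $\Psi$ as $n\to\infty$. The function $\Psi$ is continuous on $[0,1)$, $\Psi(0)=1$, $\lim_{\alpha\to1^-}\Psi(\alpha)=1$, and for $N\ge3$ $$A_F(N)=c\,\beta^{\log_F N}\,\Psi(\mathrm{relpos}_F(N))+o\bigl(\beta^{\lfloor\log_F N\rfloor}\bigr)\qquad(N\to\infty).$$ -/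

import Mathlib

open Filter Topology Set Polynomial

namespace FibSubwords

/-- The Fibonacci sequence `1, 2, 3, 5, 8, …`, with `F 0 = 1` and `F 1 = 2`. -/
def F (n : ℕ) : ℕ := Nat.fib (n + 2)

/-- The normal (Zeckendorf, greedy) representation of `n`, as a word over `{0, 1}` with the most
significant digit first. The digit of weight `F j = Nat.fib (j + 2)` is `1` iff `Nat.fib (j + 2)`
occurs in the Zeckendorf decomposition of `n`; the word has no leading zero and is empty for
`n = 0`. -/
def repF (n : ℕ) : List ℕ :=
  (List.range (Nat.greatestFib n - 1)).reverse.map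
    fun j => if j + 2 ∈ Nat.zeckendorf n then 1 else 0

/-- The value of a word `d_{ℓ-1} ⋯ d_0`, namely `∑ d_j F j`. -/
def valF : List ℕ → ℕ
  | [] => 0
  | d :: w => d * F w.length + valF w

/-- The binomial coefficient of words: the number of occurrences of `v` as a scattered subword of
`u`, that is, the number of choices of positions of `u` that spell `v`. -/
def wordBinom (u v : List ℕ) : ℕ := u.sublists.count v

/-- The number of normal representations that occur as scattered subwords of `repF n`. -/
noncomputable def sF (n : ℕ) : ℕ :=
  Set.ncard {v : List ℕ | v ∈ Set.range repF ∧ 0 < wordBinom (repF n) v}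

/-- The summatory function of `sF`. -/
noncomputable def AF (n : ℕ) : ℕ := ∑ j ∈ Finset.range (n + 1), sF j

/-- The sequence `1, 3, 6, 14, 31, …` with `B (n + 3) = 2 B (n + 2) + B (n + 1) - B n`. -/
def B : ℕ → ℤ
  | 0 => 1
  | 1 => 3
  | 2 => 6
  | n + 3 => 2 * B (n + 2) + B (n + 1) - B n

/-- `|repF n| - 1`, the index of the largest `F ℓ ≤ n` when `n ≥ 1`. -/
def ellF (n : ℕ) : ℕ := (repF n).length - 1

theorem ellF_eq (n : ℕ) : ellF n = Nat.greatestFib n - 2 := by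
  simp only [ellF, repF, List.length_map, List.length_reverse, List.length_range]; omega

theorem two_le_ellF (n : ℕ) : 2 ≤ ellF (n + 3) := by
  have h : 4 ≤ Nat.greatestFib (n + 3) := by
    rw [Nat.le_greatestFib]
    have : Nat.fib 4 = 3 := by decide
    omega
  rw [ellF_eq]; omega

theorem F_ellF_le (n : ℕ) : F (ellF (n + 3)) ≤ n + 3 := by
  have h := two_le_ellF n
  rw [ellF_eq] at h
  have e : Nat.greatestFib (n + 3) - 2 + 2 = Nat.greatestFib (n + 3) := by omega
  rw [ellF_eq, F, e]
  exact Nat.fib_greatestFib_le _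

theorem F_lt {l : ℕ} (h : 2 ≤ l) : F (l - 1) < F l := by
  obtain ⟨k, rfl⟩ := Nat.exists_eq_add_of_le h
  have e : 2 + k - 1 = k + 1 := by omega
  have e' : 2 + k = k + 2 := by omega
  rw [e, e', F, F]
  exact (Nat.fib_lt_fib_succ (by omega))

theorem F_pos (l : ℕ) : 0 < F l := Nat.fib_pos.2 (by omega)

/-- `bTerm n j` is the (total) coefficient of `B j` in the decomposition of `AF n` that is obtained
by iterating, for `m = F ℓ + r` with `ℓ ≥ 2` and `0 ≤ r < F (ℓ - 1)`, the rules
* `AF m = B ℓ - B (ℓ - 1) + AF (F (ℓ - 1) + r) + AF r` if `r < F (ℓ - 2)`,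
* `AF m = 2 B ℓ - B (ℓ - 1) - B (ℓ - 2) + 2 AF r` if `F (ℓ - 2) ≤ r`,
down to `AF 0 = 1 · B 0`, `AF 1 = 3 · B 0` and `AF 2 = 6 · B 0`. -/
def bTerm : ℕ → ℕ → ℤ
  | 0 => Pi.single 0 1
  | 1 => Pi.single 0 3
  | 2 => Pi.single 0 6
  | n + 3 =>
    if n + 3 - F (ellF (n + 3)) < F (ellF (n + 3) - 2) then
      Pi.single (ellF (n + 3)) 1 - Pi.single (ellF (n + 3) - 1) 1
        + bTerm (F (ellF (n + 3) - 1) + (n + 3 - F (ellF (n + 3))))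
        + bTerm (n + 3 - F (ellF (n + 3)))
    else
      2 • Pi.single (ellF (n + 3)) 1 - Pi.single (ellF (n + 3) - 1) 1
        - Pi.single (ellF (n + 3) - 2) 1
        + 2 • bTerm (n + 3 - F (ellF (n + 3)))
termination_by n => n
decreasing_by
  · have := F_lt (two_le_ellF n); have := F_ellF_le n; omega
  · have := F_pos (ellF (n + 3)); omega
  · have := F_pos (ellF (n + 3)); omega

/-- The letter `b_i(n)` of the `B`-decomposition `b_0(n) ⋯ b_ℓ(n)` of `AF n`, where `ℓ = ellF n`
and `AF n = ∑_{i ≤ ℓ} b_i(n) B (ℓ - i)` (and `0` for `i > ℓ`). It is used for `n ≥ 3`. -/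
def bCoeff (n i : ℕ) : ℤ := if i ≤ ellF n then bTerm n (ellF n - i) else 0

/-- The remainders of the greedy algorithm in base `φ`. -/
noncomputable def phiRem (α : ℝ) : ℕ → ℝ
  | 0 => α
  | i + 1 => Int.fract (Real.goldenRatio * phiRem α i)

/-- `phiDigit α i` is the digit `d_{i+1}` of the `φ`-expansion `d₁ d₂ d₃ ⋯` of `α ∈ [0, 1)`. -/
noncomputable def phiDigit (α : ℝ) (i : ℕ) : ℕ := ⌊Real.goldenRatio * phiRem α i⌋₊

/-- The defining property of the `φ`-expansion `d₁ d₂ d₃ ⋯` of `α`, with `d i` standing for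
`d_{i+1}`: it has sum `α`, and `∑_{i ≥ j} d_i φ^{-i} < φ^{-j+1}` for all `j ≥ 1`. -/
def IsPhiExpansion (α : ℝ) (d : ℕ → ℕ) : Prop :=
  HasSum (fun i => (d i : ℝ) / Real.goldenRatio ^ (i + 1)) α ∧
    ∀ j, ∑' i, (d (j + i) : ℝ) / Real.goldenRatio ^ (j + i + 1) < 1 / Real.goldenRatio ^ j

theorem phiRem_mem {α : ℝ} (hα : α ∈ Ico (0 : ℝ) 1) (i : ℕ) : phiRem α i ∈ Ico (0 : ℝ) 1 := by
  cases i with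
  | zero => exact hα
  | succ i => exact ⟨Int.fract_nonneg _, Int.fract_lt_one _⟩

theorem phiRem_add (α : ℝ) (j i : ℕ) : phiRem α (j + i) = phiRem (phiRem α j) i := by
  induction i with
  | zero => rfl
  | succ i ih => rw [← add_assoc, phiRem, phiRem, ih]

theorem phiDigit_add (α : ℝ) (j i : ℕ) : phiDigit α (j + i) = phiDigit (phiRem α j) i := by
  rw [phiDigit, phiDigit, phiRem_add]

theorem phiDigit_add_phiRem {α : ℝ} (hα : α ∈ Ico (0 : ℝ) 1) (i : ℕ) :
    (phiDigit α i : ℝ) + phiRem α (i + 1) = Real.goldenRatio * phiRem α i := by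
  have h0 : 0 ≤ Real.goldenRatio * phiRem α i :=
    mul_nonneg Real.goldenRatio_pos.le (phiRem_mem hα i).1
  rw [phiDigit, phiRem, natCast_floor_eq_intCast_floor h0]
  exact Int.floor_add_fract _

theorem hasSum_phiDigit {α : ℝ} (hα : α ∈ Ico (0 : ℝ) 1) :
    HasSum (fun i => (phiDigit α i : ℝ) / Real.goldenRatio ^ (i + 1)) α := by
  have hφ := Real.goldenRatio_pos
  have key : ∀ n, ∑ i ∈ Finset.range n, (phiDigit α i : ℝ) / Real.goldenRatio ^ (i + 1)
      = α - phiRem α n / Real.goldenRatio ^ n := by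
    intro n
    induction n with
    | zero => simp [phiRem]
    | succ n ih =>
      have h := phiDigit_add_phiRem hα n
      have h' : (phiDigit α n : ℝ) = Real.goldenRatio * phiRem α n - phiRem α (n + 1) := by
        linarith
      rw [Finset.sum_range_succ, ih, h']
      field_simp
      ring
  rw [hasSum_iff_tendsto_nat_of_nonneg (fun i => by positivity)]
  simp_rw [key]
  have h0 : Tendsto (fun n => phiRem α n / Real.goldenRatio ^ n) atTop (𝓝 0) := by
    have ht : Tendsto (fun n : ℕ => (Real.goldenRatio ^ n)⁻¹) atTop (𝓝 0) :=
      (tendsto_pow_atTop_atTop_of_one_lt Real.one_lt_goldenRatio).inv_tendsto_atTop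
    refine squeeze_zero (fun n => div_nonneg (phiRem_mem hα n).1 (by positivity))
      (fun n => ?_) ht
    rw [div_eq_mul_inv]
    exact mul_le_of_le_one_left (by positivity) (phiRem_mem hα n).2.le
  simpa using h0.const_sub α

theorem IsPhiExpansion.step {α : ℝ} {d : ℕ → ℕ} (h : IsPhiExpansion α d) :
    d 0 = phiDigit α 0 ∧ IsPhiExpansion (phiRem α 1) (fun i => d (i + 1)) := by
  have hφ := Real.goldenRatio_pos
  obtain ⟨hs, ht⟩ := h
  have hs1 : HasSum (fun i => (d (i + 1) : ℝ) / Real.goldenRatio ^ (i + 1))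
      (Real.goldenRatio * α - d 0) := by
    have h1 := ((hasSum_nat_add_iff' 1).2 hs).mul_left Real.goldenRatio
    simp only [Finset.range_one, Finset.sum_singleton, zero_add, pow_one] at h1
    have e1 : (fun i => (d (i + 1) : ℝ) / Real.goldenRatio ^ (i + 1)) =
        fun i => Real.goldenRatio * ((d (i + 1) : ℝ) / Real.goldenRatio ^ (i + 1 + 1)) := by
      funext i
      generalize Real.goldenRatio = x at hφ
      field_simp
      ring
    have e2 : Real.goldenRatio * α - d 0
        = Real.goldenRatio * (α - (d 0 : ℝ) / Real.goldenRatio) := by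
      generalize Real.goldenRatio = x at hφ
      field_simp
    rw [e1, e2]
    exact h1
  have hr0 : 0 ≤ Real.goldenRatio * α - d 0 := hs1.nonneg (fun i => by positivity)
  have hshift : ∀ j, ∑' i, (d (j + 1 + i) : ℝ) / Real.goldenRatio ^ (j + 1 + i + 1) =
      (1 / Real.goldenRatio) *
        ∑' i, (d (j + i + 1) : ℝ) / Real.goldenRatio ^ (j + i + 1) := by
    intro j
    rw [← tsum_mul_left]
    congr 1
    funext i
    rw [show j + 1 + i = j + i + 1 by ring]
    generalize Real.goldenRatio = x at hφ
    field_simp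
    ring
  have ht1 : ∀ j, ∑' i, (d (j + i + 1) : ℝ) / Real.goldenRatio ^ (j + i + 1)
      < 1 / Real.goldenRatio ^ j := by
    intro j
    have h1 := ht (j + 1)
    rw [hshift j, pow_succ, show 1 / (Real.goldenRatio ^ j * Real.goldenRatio) =
      1 / Real.goldenRatio * (1 / Real.goldenRatio ^ j) by field_simp] at h1
    exact lt_of_mul_lt_mul_left h1 (by positivity)
  have hr1 : Real.goldenRatio * α - d 0 < 1 := by
    have h1 := ht1 0
    simp only [zero_add, pow_zero, div_one] at h1
    rwa [hs1.tsum_eq] at h1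
  have hfl : ⌊Real.goldenRatio * α⌋ = (d 0 : ℤ) := by
    rw [Int.floor_eq_iff]
    push_cast
    constructor <;> linarith
  refine ⟨?_, ?_, ht1⟩
  · have h1 : phiDigit α 0 = ⌊Real.goldenRatio * α⌋.toNat := by
      rw [phiDigit, phiRem, Int.floor_toNat]
    rw [h1, hfl, Int.toNat_natCast]
  · have h1 : phiRem α 1 = Real.goldenRatio * α - d 0 := by
      rw [phiRem, phiRem, Int.fract, hfl, Int.cast_natCast]
    rw [h1]
    exact hs1

/-- For `α ∈ [0, 1)`, the greedy digits are the one and only `φ`-expansion of `α`. -/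
theorem isPhiExpansion_iff {α : ℝ} (hα : α ∈ Ico (0 : ℝ) 1) (d : ℕ → ℕ) :
    IsPhiExpansion α d ↔ d = phiDigit α := by
  have hφ := Real.goldenRatio_pos
  constructor
  · intro h
    funext i
    induction i generalizing α d with
    | zero => exact h.step.1
    | succ i ih =>
      rw [add_comm i 1, phiDigit_add, ← ih (phiRem_mem hα 1) _ h.step.2, add_comm]
  · rintro rfl
    refine ⟨hasSum_phiDigit hα, fun j => ?_⟩
    have h := (hasSum_phiDigit (phiRem_mem hα j)).mul_left (1 / Real.goldenRatio ^ j)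
    have e : (fun i => (phiDigit α (j + i) : ℝ) / Real.goldenRatio ^ (j + i + 1)) =
        fun i => 1 / Real.goldenRatio ^ j *
          ((phiDigit (phiRem α j) i : ℝ) / Real.goldenRatio ^ (i + 1)) := by
      funext i
      rw [phiDigit_add, add_assoc, pow_add]
      field_simp
    rw [e, h.tsum_eq]
    exact mul_lt_of_lt_one_right (by positivity) (phiRem_mem hα j).2

/-- The infinite word `1 0 d₁ d₂ d₃ ⋯`, where `d₁ d₂ d₃ ⋯` is the `φ`-expansion of `α`. -/
noncomputable def phiWord (α : ℝ) : ℕ → ℕ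
  | 0 => 1
  | 1 => 0
  | i + 2 => phiDigit α i

/-- The prefix of length `n` of the word `1 0 d₁ d₂ d₃ ⋯`. -/
noncomputable def w (n : ℕ) (α : ℝ) : List ℕ := (List.range n).map (phiWord α)

/-- The integer whose normal representation is `w n α`. -/
noncomputable def e (n : ℕ) (α : ℝ) : ℕ := valF (w n α)

/-- The letter `b_i(α)` of the limit of the `B`-decompositions of `AF (e n α)` as `n → ∞`. -/
noncomputable def bLim (α : ℝ) (i : ℕ) : ℤ := limUnder atTop fun n => bCoeff (e n α) i

/-- For `repF n = 1 0 r₁ ⋯ r_k`, the relative position `∑_{i=1}^k r_i / φ^i`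
(and `0` for `n ≤ 2`). -/
noncomputable def relposF (n : ℕ) : ℝ :=
  ∑ i ∈ Finset.range ((repF n).length - 2),
    ((repF n).getD (i + 2) 0 : ℝ) / Real.goldenRatio ^ (i + 1)

/-- `log_F n = |repF n| - 1 + relposF n`. -/
noncomputable def logF (n : ℕ) : ℝ := ((repF n).length : ℝ) - 1 + relposF n

/-- The step functions `ψ_n(α) = AF (e n α) / (c β ^ log_F (e n α))`. -/
noncomputable def psi (β c : ℝ) (n : ℕ) (α : ℝ) : ℝ :=
  (AF (e n α) : ℝ) / (c * β ^ logF (e n α))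

/-- The function `Ψ(α) = β ^ (-α) ∑_{i ≥ 0} b_i(α) / β ^ i`. -/
noncomputable def Psi (β α : ℝ) : ℝ := 1 / β ^ α * ∑' i, (bLim α i : ℝ) / β ^ i

end FibSubwords

open FibSubwords

/-!
The proof separates a combinatorial, an algebraic and an analytic part.

Combinatorics. The greedy word of `m < F L` (`pad`) is produced digit by digit, and the normal
representations are exactly the empty word and the words over `{0, 1}` without the factor `11` that
start with `1` (`mem_range_repF`). Matching subwords greedily from the left gives the recurrences of
`sF` at the words `100u` and `101u` (`sF_add_of_lt`, `sF_add_of_le`), and summing these gives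
`AF (F k - 1) = B k` and the two reduction rules for `AF` (`AF_add_of_lt`, `AF_add_of_le`). Hence
`AF m = ∑ b_i(m) B (ℓ - i)`.

Coefficients. Two inductions along the rules give all that is needed about the `b_i`: the bound
`|b_i(m)| ≤ 4 * 2 ^ i` (`abs_bTerm_mul_le`), and the locality statement that `b_i` depends only on
the first `i + 3` letters (`bTerm_prefixVal`). Since `β > 2` and the other two roots have modulus
less than `1`, so that `B n = c β ^ n + O(1)`, these imply that
`AF (e_n(α)) = c β ^ (n - 1) ∑ b_i(α) / β ^ i + O(2 ^ n)` uniformly in `α`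
(`exists_abs_AF_e_sub_le`). Uniform convergence and the asymptotics of `AF N` are immediate from
this, because every `N ≥ 3` is some `e_n(α)` with `α = relposF N`.

Continuity. It is not read off from the `b_i(α)`, which are discontinuous in `α`, but from `AF`.
By Binet's formula `√5 e_n(α) = φ ^ n (φ + α) + O(1)` (`abs_sqrt_five_mul_e_sub`), so points at
distance `φ ^ (-n)` have `e_n` at bounded distance, and the increments `sF` of `AF` below `F n` are
at most `2 ^ n`. Hence the values of `∑ b_i(α) / β ^ i` at such points differ by `O((2 / β) ^ n)`.
The same comparison, of `e_n(α)` with `F n - 1` and of `e_n(0) = F (n - 1)` with `F (n - 1) - 1`,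
yields the values at `1` and `0`.
-/

namespace FibSubwords

/-! ### Fibonacci numbers and the greedy words -/

theorem F_add_two (n : ℕ) : F (n + 2) = F (n + 1) + F n := by
  rw [F, F, F, Nat.fib_add_two (n := n + 2)]
  ring

theorem F_add_three (n : ℕ) : F (n + 3) = F (n + 2) + F (n + 1) := F_add_two (n + 1)

theorem F_zero : F 0 = 1 := rfl

theorem F_one : F 1 = 2 := rfl

theorem F_mono : Monotone F := fun _ _ h => Nat.fib_mono (by omega)

theorem F_succ_le_two_mul (n : ℕ) : F (n + 1) ≤ 2 * F n := by
  rcases n with - | n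
  · simp [F_zero, F_one]
  · have h1 : F (n + 1 + 1) = F (n + 1) + F n := F_add_two n
    have h2 := F_mono (Nat.le_add_right n 1)
    omega

theorem repF_zero : repF 0 = [] := by
  have h : Nat.greatestFib 0 < 1 := Nat.greatestFib_lt.2 (by decide)
  simp [repF, Nat.lt_one_iff.1 h]

/-- `F L ≤ m < F (L + 1)` determines the index of the leading digit of `m`. -/
theorem ellF_eq_of_le_of_lt {m L : ℕ} (h : F L ≤ m) (h' : m < F (L + 1)) : ellF m = L := by
  have h1 : L + 2 ≤ Nat.greatestFib m := Nat.le_greatestFib.2 h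
  have h2 : Nat.greatestFib m < L + 1 + 2 := Nat.greatestFib_lt.2 h'
  rw [ellF_eq]
  omega

theorem F_ellF_le_self {m : ℕ} (hm : m ≠ 0) : F (ellF m) ≤ m := by
  have h : 2 ≤ Nat.greatestFib m :=
    Nat.le_greatestFib.2 (show Nat.fib 2 ≤ m from Nat.pos_of_ne_zero hm)
  rw [ellF_eq, F, Nat.sub_add_cancel h]
  exact Nat.fib_greatestFib_le _

theorem lt_F_ellF_add_one (m : ℕ) : m < F (ellF m + 1) := by
  rw [F, ← Nat.greatestFib_lt, ellF_eq]
  omega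

theorem ellF_lt_of_lt {m L : ℕ} (h : m < F (L + 1)) : ellF m ≤ L := by
  rcases eq_or_ne m 0 with rfl | hm
  · simp [ellF, repF_zero]
  · by_contra! hL
    exact absurd (F_mono hL) (by have := F_ellF_le_self hm; simp only [Nat.succ_eq_add_one]; omega)

/-- The greedy word of `m < F L`, padded with leading zeros to length `L`. -/
def pad : ℕ → ℕ → List ℕ
  | 0, _ => []
  | L + 1, m => if F L ≤ m then 1 :: pad L (m - F L) else 0 :: pad L m

theorem pad_of_le {L m : ℕ} (h : F L ≤ m) : pad (L + 1) m = 1 :: pad L (m - F L) := by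
  simp [pad, h]

theorem pad_of_lt {L m : ℕ} (h : m < F L) : pad (L + 1) m = 0 :: pad L m := by
  simp [pad, h]

theorem length_pad (L m : ℕ) : (pad L m).length = L := by
  induction L generalizing m with
  | zero => rfl
  | succ L ih => rw [pad]; split_ifs <;> simp [ih]

theorem valF_pad {L m : ℕ} (h : m < F L) : valF (pad L m) = m := by
  induction L generalizing m with
  | zero => rw [F_zero] at h; simp [pad, valF]; omega
  | succ L ih =>
    rcases lt_or_ge m (F L) with h1 | h1
    · simp [pad_of_lt h1, valF, ih h1]
    · have h2 : m - F L < F L := by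
        have := F_succ_le_two_mul L
        omega
      simp [pad_of_le h1, valF, ih h2, length_pad]
      omega

/-- Reading off Zeckendorf digits yields the greedy word. -/
theorem map_zeckendorf_eq_pad {L m : ℕ} (h : m < F L) :
    ((List.range L).reverse.map fun j => if j + 2 ∈ Nat.zeckendorf m then 1 else 0) = pad L m := by
  induction L generalizing m with
  | zero => rfl
  | succ L ih =>
    rw [List.range_succ, List.reverse_append]
    simp only [List.reverse_cons, List.reverse_nil, List.nil_append, List.singleton_append,
      List.map_cons]
    have key : ∀ {m j}, j ∈ Nat.zeckendorf m → m < F L → j < L + 2 := by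
      intro m j hj hm
      have h1 := List.le_sum_of_mem (List.mem_map_of_mem (f := Nat.fib) hj)
      rw [Nat.sum_zeckendorf_fib] at h1
      by_contra! hc
      have := Nat.fib_mono hc
      rw [F] at hm
      omega
    rcases lt_or_ge m (F L) with h1 | h1
    · rw [pad_of_lt h1, ih h1, if_neg fun hj => by have := key hj h1; omega]
    · have hm : 0 < m := (F_pos L).trans_le h1
      have hg : Nat.greatestFib m = L + 2 := by
        have h2 := Nat.le_greatestFib.2 (show Nat.fib (L + 2) ≤ m from h1)
        have h3 := Nat.greatestFib_lt.2 (show m < Nat.fib (L + 1 + 2) from h)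
        omega
      have h2 : m - F L < F L := by
        have := F_succ_le_two_mul L
        omega
      have hz : Nat.zeckendorf m = (L + 2) :: Nat.zeckendorf (m - F L) := by
        rw [Nat.zeckendorf_of_pos hm, hg, F]
      rw [pad_of_le h1, hz, if_pos (by simp), ← ih h2]
      congr 1
      refine List.map_congr_left fun j hj => ?_
      have : j < L := by simpa using hj
      simp [show j ≠ L by omega]

theorem repF_eq_pad {L m : ℕ} (h : F L ≤ m) (h' : m < F (L + 1)) : repF m = pad (L + 1) m := by
  have h1 := Nat.le_greatestFib.2 (show Nat.fib (L + 2) ≤ m from h)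
  have h2 := Nat.greatestFib_lt.2 (show m < Nat.fib (L + 1 + 2) from h')
  rw [repF, ← map_zeckendorf_eq_pad h', show Nat.greatestFib m - 1 = L + 1 by omega]

/-- `Chain d u` says that `d u` is a word over `{0, 1}` (provided `d ≤ 1`) without the factor
`11`. Thus `Chain 0 u` means that `u` is such a word, and `Chain 1 u` that moreover `u` does not
start with `1`. -/
def Chain (d : ℕ) (u : List ℕ) : Prop := (d :: u).IsChain fun a b => a + b ≤ 1

@[simp] theorem chain_nil (d : ℕ) : Chain d [] := by simp [Chain]

@[simp] theorem chain_cons {d a : ℕ} {u : List ℕ} :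
    Chain d (a :: u) ↔ d + a ≤ 1 ∧ Chain a u := by
  simp [Chain]

theorem Chain.zero {d : ℕ} {u : List ℕ} (h : Chain d u) : Chain 0 u := by
  cases u with
  | nil => simp
  | cons a u => rw [chain_cons] at *; exact ⟨by omega, h.2⟩

theorem chain_one_iff {u : List ℕ} : Chain 1 u ↔ u = [] ∨ ∃ v, u = 0 :: v ∧ Chain 0 v := by
  cases u with
  | nil => simp
  | cons a u =>
    simp only [chain_cons, reduceCtorEq, List.cons.injEq, false_or]
    constructor
    · rintro ⟨h, h'⟩
      obtain rfl : a = 0 := by omega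
      exact ⟨u, ⟨rfl, rfl⟩, h'⟩
    · rintro ⟨v, ⟨rfl, rfl⟩, h⟩
      exact ⟨le_rfl, h⟩

theorem chain_pad {L m : ℕ} (h : m < F L) : Chain 0 (pad L m) := by
  induction L using Nat.strong_induction_on generalizing m with
  | _ L ih =>
    rcases L with - | L
    · simp [pad]
    rcases lt_or_ge m (F L) with h1 | h1
    · rw [pad_of_lt h1]
      exact chain_cons.2 ⟨by omega, ih L (by omega) h1⟩
    · rw [pad_of_le h1]
      refine chain_cons.2 ⟨by omega, ?_⟩
      rcases L with - | L
      · simp [pad]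
      have h2 : m - F (L + 1) < F L := by
        have : F (L + 1 + 1) = F (L + 1) + F L := F_add_two L
        omega
      rw [pad_of_lt h2]
      exact chain_cons.2 ⟨by omega, ih L (by omega) h2⟩

theorem valF_lt {u : List ℕ} (h : Chain 0 u) : valF u < F u.length := by
  induction hn : u.length using Nat.strong_induction_on generalizing u with
  | _ n ih =>
    subst hn
    rcases u with - | ⟨a, u⟩
    · simp [valF, F_zero]
    rw [chain_cons, zero_add] at h
    obtain ⟨h0, h1⟩ := h
    rcases Nat.le_one_iff_eq_zero_or_eq_one.1 h0 with rfl | rfl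
    · have h2 := ih u.length (by simp) h1 rfl
      have h3 := F_mono (Nat.le_succ u.length)
      simp only [valF, List.length_cons, zero_mul, zero_add]
      exact h2.trans_le h3
    · rcases chain_one_iff.1 h1 with rfl | ⟨v, rfl, hv⟩
      · simp [valF, F_zero, F_one]
      · have h2 := ih v.length (by simp) hv rfl
        have : F (v.length + 1 + 1) = F (v.length + 1) + F v.length := F_add_two _
        simp only [valF, List.length_cons]
        omega

theorem pad_valF {u : List ℕ} (h : Chain 0 u) : pad u.length (valF u) = u := by
  induction u with
  | nil => rfl
  | cons a u ih =>
    rw [chain_cons, zero_add] at h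
    obtain ⟨h0, h1⟩ := h
    have h2 := valF_lt h1.zero
    have ih := ih h1.zero
    rcases Nat.le_one_iff_eq_zero_or_eq_one.1 h0 with rfl | rfl
    · simp only [valF, zero_mul, zero_add, List.length_cons]
      rw [pad_of_lt h2, ih]
    · simp only [valF, one_mul, List.length_cons]
      rw [pad_of_le (by omega), Nat.add_sub_cancel_left, ih]

theorem repF_valF {u : List ℕ} (h : Chain 1 u) : repF (valF (1 :: u)) = 1 :: u := by
  have h1 : Chain 0 (1 :: u) := chain_cons.2 ⟨le_rfl, h⟩
  rw [repF_eq_pad (L := u.length) (by simp [valF]) (valF_lt h1)]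
  exact pad_valF h1

theorem repF_eq_cons {m : ℕ} (hm : m ≠ 0) :
    ∃ u, repF m = 1 :: u ∧ Chain 1 u ∧ u.length = ellF m ∧ valF (1 :: u) = m := by
  have h1 := F_ellF_le_self hm
  have h2 := lt_F_ellF_add_one m
  have h3 := chain_pad h2
  have h4 := valF_pad h2
  rw [pad_of_le h1] at h3 h4
  exact ⟨_, by rw [repF_eq_pad h1 h2, pad_of_le h1], (chain_cons.1 h3).2, length_pad _ _, h4⟩

theorem mem_range_repF {v : List ℕ} :
    v ∈ Set.range repF ↔ v = [] ∨ ∃ u, v = 1 :: u ∧ Chain 1 u := by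
  constructor
  · rintro ⟨m, rfl⟩
    rcases eq_or_ne m 0 with rfl | hm
    · exact Or.inl repF_zero
    · obtain ⟨u, h, hu, -⟩ := repF_eq_cons hm
      exact Or.inr ⟨u, h, hu⟩
  · rintro (rfl | ⟨u, rfl, hu⟩)
    · exact ⟨0, repF_zero⟩
    · exact ⟨_, repF_valF hu⟩

/-! ### Counting normal subwords -/

/-- The words without factor `11` (leading zeros allowed) that are subwords of `u`. -/
def freeSub (u : List ℕ) : Set (List ℕ) := {v | Chain 0 v ∧ v.Sublist u}

/-- The normal representations that are subwords of `u`. -/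
def normalSub (u : List ℕ) : Set (List ℕ) :=
  {v | (v = [] ∨ ∃ x, v = 1 :: x ∧ Chain 1 x) ∧ v.Sublist u}

theorem finite_sublists (u : List ℕ) : {v : List ℕ | v.Sublist u}.Finite := by
  refine (u.sublists.toFinset.finite_toSet).subset fun v hv => ?_
  simpa using hv

theorem finite_freeSub (u : List ℕ) : (freeSub u).Finite :=
  (finite_sublists u).subset fun _ h => h.2

theorem finite_normalSub (u : List ℕ) : (normalSub u).Finite :=
  (finite_sublists u).subset fun _ h => h.2

theorem sF_eq_ncard (m : ℕ) : sF m = (normalSub (repF m)).ncard := by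
  simp only [sF, normalSub, wordBinom, List.count_pos_iff, List.mem_sublists, mem_range_repF]

theorem cons_sublist_cons_of_ne {a b : ℕ} (h : a ≠ b) (u v : List ℕ) :
    (a :: u).Sublist (b :: v) ↔ (a :: u).Sublist v := by
  constructor
  · intro h'
    cases h' with
    | cons _ h' => exact h'
    | cons_cons _ h' => exact absurd rfl h
  · exact fun h' => h'.cons _

theorem ncard_cons_image (a : ℕ) (s : Set (List ℕ)) : (List.cons a '' s).ncard = s.ncard :=
  Set.ncard_image_of_injective _ List.cons_injective

theorem normalSub_zero_cons (u : List ℕ) : normalSub (0 :: u) = normalSub u := by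
  ext v
  simp only [normalSub, mem_ofPred_eq]
  refine and_congr_right ?_
  rintro (rfl | ⟨x, rfl, -⟩)
  · simp
  · exact cons_sublist_cons_of_ne (by omega) _ _

theorem freeSub_nil : freeSub [] = {[]} := by
  ext v
  simp only [freeSub, mem_ofPred_eq, List.sublist_nil, mem_singleton_iff]
  exact ⟨fun h => h.2, by rintro rfl; simp⟩

theorem normalSub_nil : normalSub [] = {[]} := by
  ext v
  simp only [normalSub, mem_ofPred_eq, List.sublist_nil, mem_singleton_iff]
  exact ⟨fun h => h.2, by rintro rfl; simp⟩

theorem ncard_normalSub_one : (normalSub [1]).ncard = 2 := by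
  have h : normalSub [1] = {[], [1]} := by
    ext v
    simp only [normalSub, mem_ofPred_eq, mem_insert_iff, mem_singleton_iff, List.sublist_singleton]
    refine ⟨fun h => h.2, ?_⟩
    rintro (rfl | rfl) <;> simp
  rw [h, Set.ncard_pair (by simp)]

theorem ncard_freeSub_one : (freeSub [1]).ncard = 2 := by
  have h : freeSub [1] = {[], [1]} := by
    ext v
    simp only [freeSub, mem_ofPred_eq, mem_insert_iff, mem_singleton_iff, List.sublist_singleton]
    refine ⟨fun h => h.2, ?_⟩
    rintro (rfl | rfl) <;> simp
  rw [h, Set.ncard_pair (by simp)]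

/-- The normal subwords of `10u` are the empty word, `1`, and the words `10v` with `v` a subword
of `u` without the factor `11`. -/
theorem ncard_normalSub_one_zero (u : List ℕ) :
    (normalSub (1 :: 0 :: u)).ncard = (freeSub u).ncard + 2 := by
  have h : normalSub (1 :: 0 :: u) =
      {[], [1]} ∪ List.cons 1 '' (List.cons 0 '' freeSub u) := by
    ext v
    simp only [normalSub, freeSub, chain_one_iff, mem_ofPred_eq, mem_union, mem_insert_iff,
      mem_singleton_iff, mem_image, exists_exists_and_eq_and]
    constructor
    · rintro ⟨rfl | ⟨x, rfl, rfl | ⟨y, rfl, hy⟩⟩, hs⟩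
      · simp
      · simp
      · exact Or.inr ⟨y, ⟨hy, by simpa using hs⟩, rfl⟩
    · rintro ((rfl | rfl) | ⟨y, ⟨hy, hs⟩, rfl⟩)
      · simp
      · simp
      · exact ⟨Or.inr ⟨_, rfl, Or.inr ⟨y, rfl, hy⟩⟩, by simpa using hs⟩
  rw [h, Set.ncard_union_eq ?_ (by simp) (((finite_freeSub u).image _).image _),
    ncard_cons_image, ncard_cons_image, Set.ncard_pair (by simp), add_comm]
  · rw [Set.disjoint_left]
    rintro v (rfl | rfl) <;> simp

theorem ncard_freeSub_zero (u : List ℕ) :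
    (freeSub (0 :: u)).ncard = (freeSub u).ncard + (normalSub u).ncard := by
  have h : freeSub (0 :: u) = List.cons 0 '' freeSub u ∪ normalSub u := by
    ext v
    simp only [normalSub, freeSub, mem_ofPred_eq, mem_union, mem_image]
    constructor
    · rintro ⟨hv, hs⟩
      rcases v with - | ⟨a, v⟩
      · simp
      rw [chain_cons, zero_add] at hv
      rcases Nat.le_one_iff_eq_zero_or_eq_one.1 hv.1 with rfl | rfl
      · exact Or.inl ⟨v, ⟨hv.2, by simpa using hs⟩, rfl⟩
      · exact Or.inr ⟨Or.inr ⟨v, rfl, hv.2⟩, (cons_sublist_cons_of_ne (by omega) _ _).1 hs⟩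
    · rintro (⟨y, ⟨hy, hs⟩, rfl⟩ | ⟨rfl | ⟨x, rfl, hx⟩, hs⟩)
      · exact ⟨by simpa using hy, by simpa using hs⟩
      · simp
      · exact ⟨by simpa using hx, hs.cons _⟩
  rw [h, Set.ncard_union_eq ?_ ((finite_freeSub u).image _) (finite_normalSub _),
    ncard_cons_image]
  · rw [Set.disjoint_left]
    rintro _ ⟨y, -, rfl⟩ ⟨h | ⟨x, h, -⟩, -⟩ <;> simp at h

theorem ncard_freeSub_one_zero (u : List ℕ) :
    (freeSub (1 :: 0 :: u)).ncard = (freeSub u).ncard + (normalSub (1 :: 0 :: u)).ncard := by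
  have h : freeSub (1 :: 0 :: u) = List.cons 0 '' freeSub u ∪ normalSub (1 :: 0 :: u) := by
    ext v
    simp only [normalSub, freeSub, mem_ofPred_eq, mem_union, mem_image]
    constructor
    · rintro ⟨hv, hs⟩
      rcases v with - | ⟨a, v⟩
      · simp
      rw [chain_cons, zero_add] at hv
      rcases Nat.le_one_iff_eq_zero_or_eq_one.1 hv.1 with rfl | rfl
      · rw [cons_sublist_cons_of_ne (by omega)] at hs
        exact Or.inl ⟨v, ⟨hv.2, by simpa using hs⟩, rfl⟩
      · exact Or.inr ⟨Or.inr ⟨v, rfl, hv.2⟩, hs⟩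
    · rintro (⟨y, ⟨hy, hs⟩, rfl⟩ | ⟨rfl | ⟨x, rfl, hx⟩, hs⟩)
      · exact ⟨by simpa using hy, ((List.cons_sublist_cons.2 hs)).cons _⟩
      · simp
      · exact ⟨by simpa using hx, hs⟩
  rw [h, Set.ncard_union_eq ?_ ((finite_freeSub u).image _) (finite_normalSub _),
    ncard_cons_image]
  · rw [Set.disjoint_left]
    rintro _ ⟨y, -, rfl⟩ ⟨h | ⟨x, h, -⟩, -⟩ <;> simp at h

theorem sF_eq_ncard_pad {L m : ℕ} (h : m < F L) : sF m = (normalSub (pad L m)).ncard := by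
  induction L with
  | zero =>
    obtain rfl : m = 0 := by rw [F_zero] at h; omega
    rw [sF_eq_ncard, repF_zero, pad]
  | succ L ih =>
    rcases lt_or_ge m (F L) with h1 | h1
    · rw [pad_of_lt h1, normalSub_zero_cons, ih h1]
    · rw [sF_eq_ncard, repF_eq_pad h1 h]

theorem sF_le {L m : ℕ} (h : m < F L) : sF m ≤ 2 ^ L := by
  rw [sF_eq_ncard_pad h]
  have h1 : normalSub (pad L m) ⊆ ((pad L m).sublists.toFinset : Set (List ℕ)) := by
    intro v hv
    simpa using hv.2
  have h2 := (Set.ncard_le_ncard h1 (Finset.finite_toSet _)).trans_eq (Set.ncard_coe_finset _)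
  refine h2.trans ((List.toFinset_card_le _).trans ?_)
  rw [List.length_sublists, length_pad]

theorem sF_zero : sF 0 = 1 := by
  rw [sF_eq_ncard_pad (L := 0) (by simp [F_zero]), pad, normalSub_nil, Set.ncard_singleton]

theorem sF_one : sF 1 = 2 := by
  rw [sF_eq_ncard_pad (L := 1) (by simp [F_one]), pad_of_le (by simp [F_zero]), pad,
    ncard_normalSub_one]

theorem sF_two : sF 2 = 3 := by
  have h : pad 2 2 = [1, 0] := by simp [pad, F_one, F_zero]
  rw [sF_eq_ncard_pad (L := 2) (by simp [F_add_two 0, F_one, F_zero]), h,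
    ncard_normalSub_one_zero, freeSub_nil, Set.ncard_singleton]

/-- The recurrence of `sF` at the words `100u`. -/
theorem sF_add_of_lt {k r : ℕ} (h : r < F k) :
    sF (F (k + 2) + r) = sF (F (k + 1) + r) + sF r := by
  have h1 := F_add_two k
  have h2 := F_add_three k
  have h3 := F_mono (Nat.le_succ k)
  simp only [Nat.succ_eq_add_one] at h3
  rw [sF_eq_ncard_pad (L := k + 3) (m := F (k + 2) + r) (by omega),
    sF_eq_ncard_pad (L := k + 2) (m := F (k + 1) + r) (by omega), sF_eq_ncard_pad h,
    pad_of_le (L := k + 2) (by omega), Nat.add_sub_cancel_left,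
    pad_of_lt (L := k + 1) (m := r) (by omega), pad_of_le (L := k + 1) (by omega),
    Nat.add_sub_cancel_left, pad_of_lt h, ncard_normalSub_one_zero, ncard_normalSub_one_zero,
    ncard_freeSub_zero]
  omega

/-- The recurrence of `sF` at the words `101u`. -/
theorem sF_add_of_le {k r : ℕ} (h : F k ≤ r) (h' : r < F (k + 1)) :
    sF (F (k + 2) + r) = 2 * sF r := by
  have h1 := F_add_two k
  have h2 := F_add_three k
  rw [sF_eq_ncard_pad (L := k + 3) (m := F (k + 2) + r) (by omega), sF_eq_ncard_pad h',
    pad_of_le (L := k + 2) (by omega), Nat.add_sub_cancel_left, pad_of_lt h', pad_of_le h,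
    ncard_normalSub_one_zero]
  rcases k with - | k
  · rw [pad, ncard_freeSub_one, ncard_normalSub_one]
  · have h3 : F (k + 1 + 1) = F (k + 1) + F k := F_add_two k
    rw [pad_of_lt (L := k) (by omega), ncard_freeSub_one_zero, ncard_normalSub_one_zero]
    omega

/-! ### The summatory function -/

theorem sum_sF_add_of_le {k r : ℕ} (h : r ≤ F k) :
    ∑ j ∈ Finset.range r, sF (F (k + 2) + j) =
      ∑ j ∈ Finset.range r, sF (F (k + 1) + j) + ∑ j ∈ Finset.range r, sF j := by
  rw [← Finset.sum_add_distrib]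
  refine Finset.sum_congr rfl fun j hj => sF_add_of_lt ?_
  have := Finset.mem_range.1 hj
  omega

theorem sum_sF_range_F (k : ℕ) : ((∑ j ∈ Finset.range (F k), sF j : ℕ) : ℤ) = B k := by
  induction k using Nat.strong_induction_on with
  | _ k ih =>
    match k with
    | 0 => simp [F_zero, sF_zero, B]
    | 1 => simp [F_one, sF_zero, sF_one, B, Finset.sum_range_succ]
    | 2 => simp [F_add_two 0, F_zero, F_one, sF_zero, sF_one, sF_two, B, Finset.sum_range_succ]
    | k + 3 =>
      have h0 := ih k (by omega)
      have h1 := ih (k + 1) (by omega)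
      have h2 := ih (k + 2) (by omega)
      have e1 : F (k + 3) = F (k + 2) + F (k + 1) := F_add_two (k + 1)
      have e2 := F_add_two k
      obtain ⟨t, ht⟩ := Nat.exists_eq_add_of_le (F_mono (Nat.le_succ k))
      simp only [Nat.succ_eq_add_one] at ht
      have h3 := sum_sF_add_of_le (le_refl (F k))
      have h4 : ∑ j ∈ Finset.range t, sF (F (k + 2) + (F k + j)) =
          2 * ∑ j ∈ Finset.range t, sF (F k + j) := by
        rw [Finset.mul_sum]
        refine Finset.sum_congr rfl fun j hj => sF_add_of_le (by omega) ?_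
        have := Finset.mem_range.1 hj
        omega
      have h5 : ∑ j ∈ Finset.range (F (k + 3)), sF j = ∑ j ∈ Finset.range (F (k + 2)), sF j +
          (∑ j ∈ Finset.range (F k), sF (F (k + 2) + j) +
            ∑ j ∈ Finset.range t, sF (F (k + 2) + (F k + j))) := by
        rw [e1, Finset.sum_range_add, ht, Finset.sum_range_add]
      have h6 : ∑ j ∈ Finset.range (F (k + 1)), sF j = ∑ j ∈ Finset.range (F k), sF j +
          ∑ j ∈ Finset.range t, sF (F k + j) := by
        rw [ht, Finset.sum_range_add]
      have h7 : ∑ j ∈ Finset.range (F (k + 2)), sF j = ∑ j ∈ Finset.range (F (k + 1)), sF j +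
          ∑ j ∈ Finset.range (F k), sF (F (k + 1) + j) := by
        rw [e2, Finset.sum_range_add]
      rw [B, ← h0, ← h1, ← h2]
      zify at h3 h4 h5 h6 h7 ⊢
      linarith

/-- The first reduction rule for `AF`. -/
theorem AF_add_of_lt {k r : ℕ} (h : r < F k) :
    (AF (F (k + 2) + r) : ℤ) = B (k + 2) - B (k + 1) + AF (F (k + 1) + r) + AF r := by
  have h1 := sum_sF_range_F (k + 1)
  have h2 := sum_sF_range_F (k + 2)
  have h3 := sum_sF_add_of_le (k := k) (r := r + 1) h
  simp only [AF, add_assoc, Finset.sum_range_add _ (F (k + 1)), Finset.sum_range_add _ (F (k + 2))]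
  zify at h3
  push_cast at h1 h2 ⊢
  linarith

theorem sum_sF_range_F_add_F (k : ℕ) :
    ((∑ j ∈ Finset.range (F (k + 2) + F k), sF j : ℕ) : ℤ) =
      2 * B (k + 2) - B (k + 1) + B k := by
  have h0 := sum_sF_range_F k
  have h1 := sum_sF_range_F (k + 1)
  have h2 := sum_sF_range_F (k + 2)
  have h3 := sum_sF_add_of_le (le_refl (F k))
  have h4 : ∑ j ∈ Finset.range (F (k + 2)), sF j = ∑ j ∈ Finset.range (F (k + 1)), sF j +
      ∑ j ∈ Finset.range (F k), sF (F (k + 1) + j) := by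
    rw [F_add_two, Finset.sum_range_add]
  rw [Finset.sum_range_add]
  zify at h3 h4
  push_cast at h0 h1 h2 ⊢
  linarith

/-- The second reduction rule for `AF`. -/
theorem AF_add_of_le {k r : ℕ} (h : F k ≤ r) (h' : r < F (k + 1)) :
    (AF (F (k + 2) + r) : ℤ) = 2 * B (k + 2) - B (k + 1) - B k + 2 * AF r := by
  obtain ⟨t, rfl⟩ := Nat.exists_eq_add_of_le h
  have h1 := sum_sF_range_F_add_F k
  have h0 := sum_sF_range_F k
  have h4 : ∑ j ∈ Finset.range (t + 1), sF (F (k + 2) + F k + j) =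
      2 * ∑ j ∈ Finset.range (t + 1), sF (F k + j) := by
    rw [Finset.mul_sum]
    refine Finset.sum_congr rfl fun j hj => ?_
    have := Finset.mem_range.1 hj
    rw [add_assoc, sF_add_of_le (by omega) (by omega)]
  have e1 : AF (F (k + 2) + (F k + t)) = ∑ j ∈ Finset.range (F (k + 2) + F k), sF j +
      ∑ j ∈ Finset.range (t + 1), sF (F (k + 2) + F k + j) := by
    rw [AF, ← Finset.sum_range_add]; congr 2; ring
  have e2 : AF (F k + t) = ∑ j ∈ Finset.range (F k), sF j +
      ∑ j ∈ Finset.range (t + 1), sF (F k + j) := by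
    rw [AF, ← Finset.sum_range_add, add_assoc]
  zify at h4 e1 e2
  push_cast at h0 h1
  linarith

theorem abs_AF_sub_le {L m n : ℕ} (hm : m < F L) (hn : n < F L) :
    |(AF m : ℝ) - AF n| ≤ |(m : ℝ) - n| * 2 ^ L := by
  wlog h : n ≤ m generalizing m n
  · rw [abs_sub_comm, abs_sub_comm (m : ℝ)]
    exact this hn hm (by omega)
  obtain ⟨t, rfl⟩ := Nat.exists_eq_add_of_le h
  have h1 : AF (n + t) = AF n + ∑ j ∈ Finset.range t, sF (n + 1 + j) := by
    rw [AF, AF, ← Finset.sum_range_add]; congr 2; ring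
  have h2 : ∑ j ∈ Finset.range t, sF (n + 1 + j) ≤ t * 2 ^ L := by
    refine (Finset.sum_le_card_nsmul _ _ (2 ^ L) fun j hj => sF_le ?_).trans_eq (by simp)
    have := Finset.mem_range.1 hj
    omega
  have h3 : ((∑ j ∈ Finset.range t, sF (n + 1 + j) : ℕ) : ℝ) ≤ t * 2 ^ L := by exact_mod_cast h2
  rw [h1]
  push_cast at h3 ⊢
  rw [add_sub_cancel_left, add_sub_cancel_left, abs_of_nonneg (by positivity),
    abs_of_nonneg (by positivity)]
  exact h3

/-! ### The coefficients of the `B`-decomposition -/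

theorem three_le_F_add_two (k : ℕ) : 3 ≤ F (k + 2) := F_mono (Nat.le_add_left 2 k)

theorem ellF_add {k r : ℕ} (h : r < F (k + 1)) : ellF (F (k + 2) + r) = k + 2 :=
  ellF_eq_of_le_of_lt (by omega)
    (by have := F_add_three k; rw [show k + 2 + 1 = k + 3 from rfl]; omega)

theorem bTerm_add_of_lt {k r : ℕ} (h : r < F k) :
    bTerm (F (k + 2) + r) = Pi.single (k + 2) 1 - Pi.single (k + 1) 1
      + bTerm (F (k + 1) + r) + bTerm r := by
  have h1 := ellF_add (h.trans_le (F_mono (Nat.le_add_right k 1)))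
  obtain ⟨n, hn⟩ := Nat.exists_eq_add_of_le' (three_le_F_add_two k)
  have e1 : F (k + 2) + r = n + r + 3 := by omega
  have e2 : n + r + 3 - F (k + 2) = r := by omega
  rw [e1] at h1 ⊢
  rw [bTerm, h1, e2]
  simp [h]

theorem bTerm_add_of_le {k r : ℕ} (h : F k ≤ r) (h' : r < F (k + 1)) :
    bTerm (F (k + 2) + r) = 2 • Pi.single (k + 2) 1 - Pi.single (k + 1) 1
      - Pi.single k 1 + 2 • bTerm r := by
  have h1 := ellF_add h'
  obtain ⟨n, hn⟩ := Nat.exists_eq_add_of_le' (three_le_F_add_two k)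
  have e1 : F (k + 2) + r = n + r + 3 := by omega
  have e2 : n + r + 3 - F (k + 2) = r := by omega
  rw [e1] at h1 ⊢
  rw [bTerm, h1, e2]
  simp [h]

/-- Induction along the two reduction rules for `AF`. -/
theorem greedy_induction {P : ℕ → Prop} (h0 : P 0) (h1 : P 1) (h2 : P 2)
    (hlt : ∀ k r, r < F k → P (F (k + 1) + r) → P r → P (F (k + 2) + r))
    (hle : ∀ k r, F k ≤ r → r < F (k + 1) → P r → P (F (k + 2) + r)) (m : ℕ) : P m := by
  induction m using Nat.strong_induction_on with
  | _ m ih =>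
    match m with
    | 0 => exact h0
    | 1 => exact h1
    | 2 => exact h2
    | n + 3 =>
      obtain ⟨k, hk⟩ := Nat.exists_eq_add_of_le' (two_le_ellF n)
      obtain ⟨r, hr⟩ := Nat.exists_eq_add_of_le (F_ellF_le n)
      have h3 := lt_F_ellF_add_one (n + 3)
      rw [hk] at hr h3
      have e1 : F (k + 2 + 1) = F (k + 2) + F (k + 1) := F_add_three k
      have e2 := F_add_two k
      have e3 := F_pos k
      have e4 := F_pos (k + 1)
      rw [hr]
      rcases lt_or_ge r (F k) with h | h
      · exact hlt k r h (ih _ (by omega)) (ih _ (by omega))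
      · exact hle k r h (by omega) (ih _ (by omega))

theorem ellF_zero : ellF 0 = 0 := by simp [ellF, repF_zero]

theorem ellF_one : ellF 1 = 0 := ellF_eq_of_le_of_lt (by simp [F_zero]) (by simp [F_one])

theorem ellF_two : ellF 2 = 1 :=
  ellF_eq_of_le_of_lt (by simp [F_one]) (by simp [F_add_two, F_one, F_zero])

theorem bTerm_eq_zero {m j : ℕ} (h : ellF m < j) : bTerm m j = 0 := by
  induction m using greedy_induction with
  | h0 => simp [bTerm, Pi.single_apply]; omega
  | h1 => simp [bTerm, Pi.single_apply]; omega
  | h2 => simp [bTerm, Pi.single_apply]; omega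
  | hlt k r hr ih1 ih2 =>
    have hr1 := hr.trans_le (F_mono (Nat.le_add_right k 1))
    rw [ellF_add hr1] at h
    have e1 : ellF (F (k + 1) + r) = k + 1 := ellF_eq_of_le_of_lt (by omega)
      (by have := F_add_two k; rw [show k + 1 + 1 = k + 2 from rfl]; omega)
    have e2 : ellF r ≤ k := ellF_lt_of_lt hr1
    simp [bTerm_add_of_lt hr, ih1 (by omega), ih2 (by omega),
      show j ≠ k + 2 by omega, show j ≠ k + 1 by omega]
  | hle k r hr hr1 ih =>
    rw [ellF_add hr1] at h
    have e2 : ellF r ≤ k := ellF_lt_of_lt hr1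
    simp [bTerm_add_of_le hr hr1, ih (by omega),
      show j ≠ k + 2 by omega, show j ≠ k + 1 by omega, show j ≠ k by omega]

theorem bTerm_eq_zero_of_lt {m j : ℕ} (hm : m < F j) (hj : j ≠ 0) : bTerm m j = 0 := by
  obtain ⟨k, rfl⟩ := Nat.exists_eq_succ_of_ne_zero hj
  exact bTerm_eq_zero (Nat.lt_succ_of_le (ellF_lt_of_lt hm))

/-- The coefficients grow at most like `2 ^ i`, where `i` is the distance from the leading one.
The constant `4` is what makes the induction close: both rules add up to exactly `4 * 2 ^ ℓ`. -/
theorem abs_bTerm_mul_le (m j : ℕ) : |bTerm m j| * 2 ^ j ≤ 4 * 2 ^ ellF m := by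
  induction m using greedy_induction with
  | h0 => rcases eq_or_ne j 0 with rfl | hj <;> simp [bTerm, *, ellF_zero]
  | h1 => rcases eq_or_ne j 0 with rfl | hj <;> simp [bTerm, *, ellF_one]
  | h2 => rcases eq_or_ne j 0 with rfl | hj <;> simp [bTerm, *, ellF_two]
  | hlt k r hr ih1 ih2 =>
    have hr1 := hr.trans_le (F_mono (Nat.le_add_right k 1))
    have e1 : ellF (F (k + 1) + r) = k + 1 := ellF_eq_of_le_of_lt (by omega)
      (by have := F_add_two k; rw [show k + 1 + 1 = k + 2 from rfl]; omega)
    have e2 : (2 : ℤ) ^ ellF r ≤ 2 ^ k := pow_le_pow_right₀ (by norm_num) (ellF_lt_of_lt hr1)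
    have hs0 : |(Pi.single (k + 2) 1 - Pi.single (k + 1) 1 : ℕ → ℤ) j| * 2 ^ j ≤ 2 ^ (k + 2) := by
      rcases eq_or_ne j (k + 2) with rfl | h2
      · simp
      · rcases eq_or_ne j (k + 1) with rfl | h3
        · simp [pow_succ]
        · simp [h2, h3]
    rw [e1] at ih1
    rw [ellF_add hr1, bTerm_add_of_lt hr]
    generalize (Pi.single (k + 2) 1 - Pi.single (k + 1) 1 : ℕ → ℤ) = g at hs0
    simp only [Pi.add_apply]
    calc _ ≤ (|g j| + |bTerm (F (k + 1) + r) j| + |bTerm r j|) * 2 ^ j := by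
          gcongr; exact abs_add_three _ _ _
      _ ≤ 4 * 2 ^ (k + 2) := by
          rw [pow_succ, pow_succ] at hs0 ⊢
          rw [pow_succ] at ih1
          linarith
  | hle k r hr hr1 ih =>
    have e2 : (2 : ℤ) ^ ellF r ≤ 2 ^ k := pow_le_pow_right₀ (by norm_num) (ellF_lt_of_lt hr1)
    have hs0 : |(2 • Pi.single (k + 2) 1 - Pi.single (k + 1) 1 - Pi.single k 1 : ℕ → ℤ) j| * 2 ^ j
        ≤ 2 * 2 ^ (k + 2) := by
      rcases eq_or_ne j (k + 2) with rfl | h2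
      · simp
      · rcases eq_or_ne j (k + 1) with rfl | h3
        · simp [pow_succ]; nlinarith [pow_pos (show (0 : ℤ) < 2 by norm_num) k]
        · rcases eq_or_ne j k with rfl | h4
          · simp [pow_succ]; nlinarith [pow_pos (show (0 : ℤ) < 2 by norm_num) j]
          · simp [h2, h3, h4]
    rw [ellF_add hr1, bTerm_add_of_le hr hr1]
    generalize (2 • Pi.single (k + 2) 1 - Pi.single (k + 1) 1 - Pi.single k 1 : ℕ → ℤ) = g at hs0
    simp only [Pi.add_apply, Pi.smul_apply]
    calc _ ≤ (|g j| + 2 * |bTerm r j|) * 2 ^ j := by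
          gcongr
          refine (abs_add_le _ _).trans_eq ?_
          rw [nsmul_eq_mul, abs_mul]; simp
      _ ≤ 4 * 2 ^ (k + 2) := by
          rw [pow_succ, pow_succ] at hs0 ⊢
          linarith

theorem AF_eq_sum_bTerm {m L : ℕ} (h : ellF m < L) :
    (AF m : ℤ) = ∑ j ∈ Finset.range L, bTerm m j * B j := by
  have hsum : ∀ {a : ℕ} (x : ℤ), a < L →
      ∑ j ∈ Finset.range L, (Pi.single a x : ℕ → ℤ) j * B j = x * B a := by
    intro a x ha
    simp [Pi.single_apply, ha]
  induction m using greedy_induction with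
  | h0 =>
    rw [bTerm, hsum _ (by omega)]
    simp [AF, sF_zero, B]
  | h1 =>
    rw [bTerm, hsum _ (by omega)]
    simp [AF, sF_zero, sF_one, B, Finset.sum_range_succ]
  | h2 =>
    rw [bTerm, hsum _ (by omega)]
    simp [AF, sF_zero, sF_one, sF_two, B, Finset.sum_range_succ]
  | hlt k r hr ih1 ih2 =>
    have hr1 := hr.trans_le (F_mono (Nat.le_add_right k 1))
    rw [ellF_add hr1] at h
    have e1 : ellF (F (k + 1) + r) = k + 1 := ellF_eq_of_le_of_lt (by omega)
      (by have := F_add_two k; rw [show k + 1 + 1 = k + 2 from rfl]; omega)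
    have e2 : ellF r ≤ k := ellF_lt_of_lt hr1
    rw [AF_add_of_lt hr, bTerm_add_of_lt hr, ih1 (by omega), ih2 (by omega)]
    simp only [Pi.add_apply, Pi.sub_apply, add_mul, sub_mul, Finset.sum_add_distrib,
      Finset.sum_sub_distrib]
    rw [hsum _ (by omega), hsum _ (by omega)]
    ring
  | hle k r hr hr1 ih =>
    rw [ellF_add hr1] at h
    have e2 : ellF r ≤ k := ellF_lt_of_lt hr1
    rw [AF_add_of_le hr hr1, bTerm_add_of_le hr hr1, ih (by omega)]
    simp only [Pi.add_apply, Pi.sub_apply, Pi.smul_apply, add_mul, sub_mul,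
      Finset.sum_add_distrib, Finset.sum_sub_distrib, smul_mul_assoc, ← Finset.smul_sum]
    rw [hsum _ (by omega), hsum _ (by omega), hsum _ (by omega)]
    ring

theorem abs_bCoeff_le (m i : ℕ) : |bCoeff m i| ≤ 4 * 2 ^ i := by
  rw [bCoeff]
  split_ifs with h
  · have h1 := abs_bTerm_mul_le m (ellF m - i)
    nth_rewrite 3 [← Nat.sub_add_cancel h] at h1
    rw [pow_add] at h1
    have h2 : (0 : ℤ) < 2 ^ (ellF m - i) := by positivity
    refine le_of_mul_le_mul_right ?_ h2
    linarith
  · simp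

theorem AF_eq_sum_bCoeff (m : ℕ) :
    (AF m : ℤ) = ∑ i ∈ Finset.range (ellF m + 1), bCoeff m i * B (ellF m - i) := by
  rw [AF_eq_sum_bTerm (Nat.lt_succ_self _), ← Finset.sum_range_reflect]
  refine Finset.sum_congr rfl fun i hi => ?_
  have : i ≤ ellF m := by have := Finset.mem_range.1 hi; omega
  rw [bCoeff, if_pos this, show ellF m + 1 - 1 - i = ellF m - i by omega]

/-! ### Prefixes of infinite words -/

/-- The value of the prefix of length `n` of the infinite word `d`. -/
def prefixVal (d : ℕ → ℕ) (n : ℕ) : ℕ := valF ((List.range n).map d)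

theorem map_range_succ_eq_cons (d : ℕ → ℕ) (n : ℕ) :
    (List.range (n + 1)).map d = d 0 :: (List.range n).map fun i => d (i + 1) := by
  rw [List.range_succ_eq_map, List.map_cons, List.map_map]
  rfl

theorem prefixVal_succ (d : ℕ → ℕ) (n : ℕ) :
    prefixVal d (n + 1) = d 0 * F n + prefixVal (fun i => d (i + 1)) n := by
  rw [prefixVal, map_range_succ_eq_cons, valF, List.length_map, List.length_range, prefixVal]

theorem chain_map_range {d : ℕ → ℕ} (hd : ∀ i, d i + d (i + 1) ≤ 1) {a : ℕ} (ha : a + d 0 ≤ 1)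
    (n : ℕ) : Chain a ((List.range n).map d) := by
  induction n generalizing d a with
  | zero => simp
  | succ n ih =>
    rw [map_range_succ_eq_cons, chain_cons]
    exact ⟨ha, ih (fun i => hd (i + 1)) (hd 0)⟩

theorem prefixVal_lt {d : ℕ → ℕ} (hd : ∀ i, d i + d (i + 1) ≤ 1) (n : ℕ) :
    prefixVal d n < F n := by
  have h := valF_lt (chain_map_range hd (a := 0) (by have := hd 0; omega) n)
  simpa [prefixVal] using h

/-- The coefficient at distance `i` from the front only depends on the first `i + 3` letters. -/
theorem bTerm_prefixVal {d : ℕ → ℕ} (hd : ∀ i, d i + d (i + 1) ≤ 1) (i t : ℕ) :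
    bTerm (prefixVal d (i + 3 + t)) (t + 2) = bTerm (prefixVal d (i + 3)) 2 := by
  induction i using Nat.strong_induction_on generalizing d with
  | _ i ih =>
    -- shifting both positions leaves the coefficients of the rules unchanged
    have hsingle : ∀ a : ℕ, (Pi.single (a + t) 1 : ℕ → ℤ) (t + 2) = (Pi.single a 1 : ℕ → ℤ) 2 := by
      intro a
      simp only [Pi.single_apply, show t + 2 = a + t ↔ 2 = a by omega]
    have hd1 : ∀ i, d (i + 1) + d (i + 1 + 1) ≤ 1 := fun i => hd (i + 1)
    have hd2 : ∀ i, d (i + 1 + 1) + d (i + 1 + 1 + 1) ≤ 1 := fun i => hd (i + 2)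
    have e0 : prefixVal d (i + 3 + t) =
        d 0 * F (i + t + 2) + prefixVal (fun i => d (i + 1)) (i + t + 2) := by
      rw [← prefixVal_succ]; congr 1; omega
    have e0' : prefixVal d (i + 3) =
        d 0 * F (i + 2) + prefixVal (fun i => d (i + 1)) (i + 2) := prefixVal_succ d _
    -- the remainder behind a first letter, read one position later
    have hrem : bTerm (prefixVal (fun i => d (i + 1)) (i + t + 2)) (t + 2) =
        bTerm (prefixVal (fun i => d (i + 1)) (i + 2)) 2 := by
      rcases i with - | i
      · rw [bTerm_eq_zero_of_lt (by simpa using prefixVal_lt hd1 (0 + t + 2)) (by omega),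
          bTerm_eq_zero_of_lt (prefixVal_lt hd1 2) (by omega)]
      · rw [show i + 1 + t + 2 = i + 3 + t by omega]
        exact ih i (by omega) hd1
    have h01 : d 0 + d 1 ≤ 1 := hd 0
    rcases Nat.le_one_iff_eq_zero_or_eq_one.1 (show d 0 ≤ 1 by omega) with h0 | h0
    · rw [e0, e0', h0]
      simpa using hrem
    have h1 : d 1 = 0 := by omega
    have e1 : ∀ n, prefixVal (fun i => d (i + 1)) (n + 1) =
        prefixVal (fun i => d (i + 1 + 1)) n := by
      intro n
      simp [prefixVal_succ (fun i => d (i + 1)), h1]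
    have e2 : ∀ n, prefixVal (fun i => d (i + 1 + 1)) (n + 1) =
        d 2 * F n + prefixVal (fun i => d (i + 1 + 1 + 1)) n := by
      intro n
      simp [prefixVal_succ (fun i => d (i + 1 + 1))]
    rw [e0, e0', h0, one_mul, one_mul]
    have h23 : d 2 + d 3 ≤ 1 := hd 2
    rcases Nat.le_one_iff_eq_zero_or_eq_one.1 (show d 2 ≤ 1 by omega) with h2 | h2
    · have hlt : ∀ n, prefixVal (fun i => d (i + 1)) (n + 2) < F n := by
        intro n
        rw [e1, e2, h2, zero_mul, zero_add]
        exact prefixVal_lt (fun i => hd (i + 3)) n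
      rw [bTerm_add_of_lt (hlt _), bTerm_add_of_lt (hlt _)]
      -- the word obtained by deleting one zero
      set d' : ℕ → ℕ := fun n => if n = 0 then 1 else d (n + 1) with hd'
      have hd'a : ∀ i, d' i + d' (i + 1) ≤ 1 := by
        rintro (- | i)
        · simp [hd', h2]
        · simpa [hd'] using hd (i + 2)
      have e3 : ∀ n, F (n + 1) + prefixVal (fun i => d (i + 1)) (n + 2) = prefixVal d' (n + 2) := by
        intro n
        rw [e1, prefixVal_succ d']
        simp [hd']
      have hdel : bTerm (F (i + t + 1) + prefixVal (fun i => d (i + 1)) (i + t + 2)) (t + 2) =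
          bTerm (F (i + 1) + prefixVal (fun i => d (i + 1)) (i + 2)) 2 := by
        rw [e3, e3]
        rcases i with - | i
        · rw [bTerm_eq_zero_of_lt (by simpa using prefixVal_lt hd'a (0 + t + 2)) (by omega),
            bTerm_eq_zero_of_lt (prefixVal_lt hd'a 2) (by omega)]
        · rw [show i + 1 + t + 2 = i + 3 + t by omega]
          exact ih i (by omega) hd'a
      simp only [Pi.add_apply, Pi.sub_apply]
      rw [hdel, hrem, show i + t + 2 = i + 2 + t by omega, show i + t + 1 = i + 1 + t by omega,
        hsingle, hsingle]
    · have hle : ∀ n, F n ≤ prefixVal (fun i => d (i + 1)) (n + 2) := by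
        intro n
        rw [e1, e2, h2, one_mul]
        exact Nat.le_add_right _ _
      have hlt : ∀ n, prefixVal (fun i => d (i + 1)) (n + 2) < F (n + 1) := by
        intro n
        rw [e1]
        exact prefixVal_lt hd2 _
      rw [bTerm_add_of_le (hle _) (hlt _), bTerm_add_of_le (hle _) (hlt _)]
      simp only [Pi.add_apply, Pi.sub_apply, Pi.smul_apply]
      rw [hrem, show i + t + 2 = i + 2 + t by omega, show i + t + 1 = i + 1 + t by omega,
        hsingle, hsingle, hsingle]

/-! ### The words attached to `φ`-expansions -/

theorem phiDigit_le_one {α : ℝ} (hα : α ∈ Ico (0 : ℝ) 1) (i : ℕ) : phiDigit α i ≤ 1 := by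
  have h1 := (phiRem_mem hα i).2
  have h2 := (phiRem_mem hα (i + 1)).1
  have h3 := phiDigit_add_phiRem hα i
  have h4 := Real.goldenRatio_lt_two
  have h5 := Real.goldenRatio_pos
  have h6 : (phiDigit α i : ℝ) < 2 := by nlinarith
  have : phiDigit α i < 2 := by exact_mod_cast h6
  omega

theorem phiDigit_add_phiDigit_succ_le {α : ℝ} (hα : α ∈ Ico (0 : ℝ) 1) (i : ℕ) :
    phiDigit α i + phiDigit α (i + 1) ≤ 1 := by
  have h0 := phiDigit_le_one hα i
  have h0' := phiDigit_le_one hα (i + 1)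
  by_contra! h
  have e1 : phiDigit α i = 1 := by omega
  have e2 : phiDigit α (i + 1) = 1 := by omega
  have h1 := (phiRem_mem hα i).2
  have h2 := (phiRem_mem hα (i + 1 + 1)).1
  have h3 := phiDigit_add_phiRem hα i
  have h4 := phiDigit_add_phiRem hα (i + 1)
  rw [e1] at h3
  rw [e2] at h4
  have h5 := Real.goldenRatio_pos
  have h6 := Real.goldenRatio_sq
  push_cast at h3 h4
  nlinarith

theorem phiWord_add_succ_le {α : ℝ} (hα : α ∈ Ico (0 : ℝ) 1) (i : ℕ) :
    phiWord α i + phiWord α (i + 1) ≤ 1 := by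
  match i with
  | 0 => simp [phiWord]
  | 1 => simpa [phiWord] using phiDigit_le_one hα 0
  | i + 2 => simpa [phiWord] using phiDigit_add_phiDigit_succ_le hα i

theorem e_eq_prefixVal (n : ℕ) (α : ℝ) : e n α = prefixVal (phiWord α) n := rfl

theorem w_add_two (n : ℕ) (α : ℝ) :
    w (n + 2) α = 1 :: 0 :: (List.range n).map (phiDigit α) := by
  rw [w, map_range_succ_eq_cons, map_range_succ_eq_cons]
  rfl

theorem repF_e {α : ℝ} (hα : α ∈ Ico (0 : ℝ) 1) (n : ℕ) : repF (e (n + 1) α) = w (n + 1) α := by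
  rw [e, w, map_range_succ_eq_cons]
  exact repF_valF (chain_map_range (fun i => phiWord_add_succ_le hα (i + 1))
    (phiWord_add_succ_le hα 0) n)

theorem ellF_e {α : ℝ} (hα : α ∈ Ico (0 : ℝ) 1) (n : ℕ) : ellF (e (n + 1) α) = n := by
  rw [ellF, repF_e hα, w, List.length_map, List.length_range, Nat.add_sub_cancel]

theorem e_lt {α : ℝ} (hα : α ∈ Ico (0 : ℝ) 1) (n : ℕ) : e n α < F n :=
  prefixVal_lt (phiWord_add_succ_le hα) n

theorem bCoeff_e_eq {α : ℝ} (hα : α ∈ Ico (0 : ℝ) 1) {i n : ℕ} (h : i + 3 ≤ n) :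
    bCoeff (e n α) i = bTerm (e (i + 3) α) 2 := by
  obtain ⟨t, rfl⟩ := Nat.exists_eq_add_of_le h
  have h1 : ellF (e (i + 3 + t) α) = i + 2 + t := by
    rw [show i + 3 + t = i + 2 + t + 1 by omega, ellF_e hα]
  rw [bCoeff, h1, if_pos (by omega), show i + 2 + t - i = t + 2 by omega]
  exact bTerm_prefixVal (phiWord_add_succ_le hα) i t

/-- `b_i(e_n(α))` has reached its limit as soon as `n ≥ i + 3`. -/
theorem bCoeff_e {α : ℝ} (hα : α ∈ Ico (0 : ℝ) 1) {i n : ℕ} (h : i + 3 ≤ n) :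
    bCoeff (e n α) i = bLim α i := by
  have h1 : Tendsto (fun n => bCoeff (e n α) i) atTop (𝓝 (bTerm (e (i + 3) α) 2)) :=
    tendsto_const_nhds.congr' ((eventually_ge_atTop (i + 3)).mono fun n hn =>
      (bCoeff_e_eq hα hn).symm)
  rw [bCoeff_e_eq hα h, bLim, h1.limUnder_eq]

theorem abs_bLim_le {α : ℝ} (hα : α ∈ Ico (0 : ℝ) 1) (i : ℕ) : |(bLim α i : ℝ)| ≤ 4 * 2 ^ i := by
  rw [← bCoeff_e hα le_rfl]
  exact_mod_cast abs_bCoeff_le _ i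

/-! ### The characteristic polynomial of `B` -/

/-- `X³ - 2X² - X + 1` has one root in each of `(-0.9, -0.8)`, `(0.5, 0.6)` and `(2.2, 2.3)`; the
roots are described by Vieta's formulas. -/
theorem exists_roots : ∃ β β₂ β₃ : ℝ,
    (22 / 10 < β ∧ β < 23 / 10) ∧ (5 / 10 < β₂ ∧ β₂ < 6 / 10) ∧ (-9 / 10 < β₃ ∧ β₃ < -8 / 10) ∧
    β + β₂ + β₃ = 2 ∧ β * β₂ + β * β₃ + β₂ * β₃ = -1 ∧ β * β₂ * β₃ = -1 := by
  set f : ℝ → ℝ := fun x => x ^ 3 - 2 * x ^ 2 - x + 1 with hf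
  have hc : Continuous f := by fun_prop
  obtain ⟨β, hβ, h1⟩ := intermediate_value_Ioo (show (22 / 10 : ℝ) ≤ 23 / 10 by norm_num)
    hc.continuousOn (show (0 : ℝ) ∈ Ioo (f (22 / 10)) (f (23 / 10)) by norm_num [hf])
  obtain ⟨β₂, hβ₂, h2⟩ := intermediate_value_Ioo' (show (5 / 10 : ℝ) ≤ 6 / 10 by norm_num)
    hc.continuousOn (show (0 : ℝ) ∈ Ioo (f (6 / 10)) (f (5 / 10)) by norm_num [hf])
  obtain ⟨β₃, hβ₃, h3⟩ := intermediate_value_Ioo (show (-9 / 10 : ℝ) ≤ -8 / 10 by norm_num)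
    hc.continuousOn (show (0 : ℝ) ∈ Ioo (f (-9 / 10)) (f (-8 / 10)) by norm_num [hf])
  simp only [hf] at h1 h2 h3
  have n12 : β - β₂ ≠ 0 := by have := hβ.1; have := hβ₂.2; linarith
  have n23 : β₂ - β₃ ≠ 0 := by have := hβ₂.1; have := hβ₃.2; linarith
  have n13 : β - β₃ ≠ 0 := by have := hβ.1; have := hβ₃.2; linarith
  have q12 : β ^ 2 + β * β₂ + β₂ ^ 2 - 2 * (β + β₂) - 1 = 0 :=
    mul_left_cancel₀ n12 (by linear_combination h1 - h2)
  have q13 : β ^ 2 + β * β₃ + β₃ ^ 2 - 2 * (β + β₃) - 1 = 0 :=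
    mul_left_cancel₀ n13 (by linear_combination h1 - h3)
  have s1 : β + β₂ + β₃ = 2 := mul_left_cancel₀ n23 (by linear_combination q12 - q13)
  have s2 : β * β₂ + β * β₃ + β₂ * β₃ = -1 := by
    linear_combination (β + β₂) * s1 - q12
  refine ⟨β, β₂, β₃, hβ, hβ₂, hβ₃, s1, s2, ?_⟩
  linear_combination h1 - β ^ 2 * s1 + β * s2

/-- The closed form of `B`, with coefficients obtained by solving the Vandermonde system. -/
theorem B_closed_form {β β₂ β₃ : ℝ} (n12 : β - β₂ ≠ 0) (n13 : β - β₃ ≠ 0) (n23 : β₂ - β₃ ≠ 0)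
    (s1 : β + β₂ + β₃ = 2) (s2 : β * β₂ + β * β₃ + β₂ * β₃ = -1) (s3 : β * β₂ * β₃ = -1) (n : ℕ) :
    (B n : ℝ) = (6 - 3 * (β₂ + β₃) + β₂ * β₃) / ((β - β₂) * (β - β₃)) * β ^ n
      + (6 - 3 * (β + β₃) + β * β₃) / ((β₂ - β) * (β₂ - β₃)) * β₂ ^ n
      + (6 - 3 * (β + β₂) + β * β₂) / ((β₃ - β) * (β₃ - β₂)) * β₃ ^ n := by
  have r1 : β ^ 3 = 2 * β ^ 2 + β - 1 := by linear_combination β ^ 2 * s1 - β * s2 + s3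
  have r2 : β₂ ^ 3 = 2 * β₂ ^ 2 + β₂ - 1 := by linear_combination β₂ ^ 2 * s1 - β₂ * s2 + s3
  have r3 : β₃ ^ 3 = 2 * β₃ ^ 2 + β₃ - 1 := by linear_combination β₃ ^ 2 * s1 - β₃ * s2 + s3
  have n21 : β₂ - β ≠ 0 := fun h => n12 (by linarith)
  have n31 : β₃ - β ≠ 0 := fun h => n13 (by linarith)
  have n32 : β₃ - β₂ ≠ 0 := fun h => n23 (by linarith)
  induction n using Nat.strong_induction_on with
  | _ n ih =>
    match n with
    | 0 => simp only [B]; push_cast; field_simp; ring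
    | 1 => simp only [B]; push_cast; field_simp; ring
    | 2 => simp only [B]; push_cast; field_simp; ring
    | n + 3 =>
      rw [B]
      push_cast
      rw [ih (n + 2) (by omega), ih (n + 1) (by omega), ih n (by omega)]
      generalize (6 - 3 * (β₂ + β₃) + β₂ * β₃) / ((β - β₂) * (β - β₃)) = x
      generalize (6 - 3 * (β + β₃) + β * β₃) / ((β₂ - β) * (β₂ - β₃)) = y
      generalize (6 - 3 * (β + β₂) + β * β₂) / ((β₃ - β) * (β₃ - β₂)) = z
      linear_combination (-x * β ^ n) * r1 - y * β₂ ^ n * r2 - z * β₃ ^ n * r3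

/-! ### Values of words and relative positions -/

/-- The number `∑ u_i / φ ^ (i + 1)` with digits `u`. -/
noncomputable def relVal : List ℕ → ℝ
  | [] => 0
  | a :: u => (a + relVal u) / Real.goldenRatio

theorem relVal_nonneg (u : List ℕ) : 0 ≤ relVal u := by
  induction u with
  | nil => exact le_rfl
  | cons a u ih => rw [relVal]; have := Real.goldenRatio_pos; positivity

theorem relVal_lt_one {u : List ℕ} (h : Chain 0 u) : relVal u < 1 := by
  have h1 := Real.one_lt_goldenRatio
  have h2 := Real.goldenRatio_pos
  have h3 := Real.goldenRatio_sq
  induction hn : u.length using Nat.strong_induction_on generalizing u with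
  | _ n ih =>
    subst hn
    rcases u with - | ⟨a, u⟩
    · simp [relVal]
    rw [chain_cons, zero_add] at h
    rw [relVal, div_lt_one h2]
    rcases Nat.le_one_iff_eq_zero_or_eq_one.1 h.1 with rfl | rfl
    · have h4 := ih u.length (by simp) h.2 rfl
      push_cast
      linarith
    · rcases chain_one_iff.1 h.2 with rfl | ⟨v, rfl, hv⟩
      · simpa [relVal] using h1
      · have h4 := ih v.length (by simp) hv rfl
        have h5 : relVal v / Real.goldenRatio < Real.goldenRatio - 1 := by
          rw [div_lt_iff₀ h2]
          nlinarith
        simp only [relVal]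
        push_cast
        rw [zero_add]
        linarith

theorem relVal_eq_sum (u : List ℕ) :
    relVal u = ∑ i ∈ Finset.range u.length, (u.getD i 0 : ℝ) / Real.goldenRatio ^ (i + 1) := by
  induction u with
  | nil => simp [relVal]
  | cons a u ih =>
    rw [relVal, List.length_cons, Finset.sum_range_succ', ih, add_div, Finset.sum_div, add_comm]
    congr 1
    · refine Finset.sum_congr rfl fun i _ => ?_
      rw [List.getD_cons_succ, pow_succ _ (i + 1), div_div]
    · simp

theorem relVal_map_range (d : ℕ → ℕ) (n : ℕ) :
    relVal ((List.range n).map d) =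
      ∑ i ∈ Finset.range n, (d i : ℝ) / Real.goldenRatio ^ (i + 1) := by
  rw [relVal_eq_sum, List.length_map, List.length_range]
  refine Finset.sum_congr rfl fun i hi => ?_
  rw [List.getD_eq_getElem _ _ (by simpa using hi)]
  simp

theorem phiRem_relVal {u : List ℕ} (h : Chain 0 u) (i : ℕ) :
    phiRem (relVal u) i = relVal (u.drop i) := by
  have h2 := Real.goldenRatio_pos
  induction i generalizing u with
  | zero => rfl
  | succ i ih =>
    rw [add_comm i 1, phiRem_add, phiRem, phiRem, add_comm 1 i]
    rcases u with - | ⟨a, u⟩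
    · have := ih (u := []) h
      simpa [relVal] using this
    · rw [List.drop_succ_cons, ← ih (chain_cons.1 h).2.zero]
      congr 1
      have h0 := relVal_nonneg u
      have h1 := relVal_lt_one (chain_cons.1 h).2.zero
      rw [relVal, mul_div_cancel₀ _ h2.ne', add_comm, Int.fract_add_natCast,
        Int.fract_eq_self.2 ⟨h0, h1⟩]

/-- A finite normal word, followed by zeros, is the `φ`-expansion of its value. -/
theorem phiDigit_relVal {u : List ℕ} (h : Chain 0 u) (i : ℕ) :
    phiDigit (relVal u) i = u.getD i 0 := by
  have h2 := Real.goldenRatio_pos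
  rw [phiDigit, phiRem_relVal h]
  induction i generalizing u with
  | zero =>
    rcases u with - | ⟨a, u⟩
    · simp [relVal]
    · have h0 := relVal_nonneg u
      have h1 := relVal_lt_one (chain_cons.1 h).2.zero
      rw [List.drop_zero, relVal, mul_div_cancel₀ _ h2.ne', List.getD_cons_zero,
        Nat.floor_eq_iff (by positivity)]
      constructor <;> linarith
  | succ i ih =>
    rcases u with - | ⟨a, u⟩
    · simp [relVal]
    · rw [List.drop_succ_cons, List.getD_cons_succ]
      exact ih (chain_cons.1 h).2.zero

theorem abs_goldenConj : |Real.goldenConj| = Real.goldenRatio - 1 := by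
  rw [abs_of_neg Real.goldenConj_neg]
  linarith [Real.goldenRatio_add_goldenConj]

theorem abs_sqrt_five_mul_F_sub (n : ℕ) :
    |√5 * F n - Real.goldenRatio ^ (n + 2)| = (Real.goldenRatio - 1) ^ (n + 2) := by
  have h : √5 * F n - Real.goldenRatio ^ (n + 2) = -Real.goldenConj ^ (n + 2) := by
    rw [F, Real.coe_fib_eq]
    field_simp
    ring
  rw [h, abs_neg, abs_pow, abs_goldenConj]

/-- Binet's formula for words: the error terms form a geometric series with sum at most `1`. -/
theorem abs_sqrt_five_mul_valF_sub {u : List ℕ} (h : Chain 0 u) :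
    |√5 * valF u - Real.goldenRatio ^ (u.length + 2) * relVal u| ≤
      1 - (Real.goldenRatio - 1) ^ u.length := by
  have h1 := Real.one_lt_goldenRatio
  have h2 := Real.goldenRatio_pos
  have h3 := Real.goldenRatio_sq
  induction u with
  | nil => simp [valF, relVal]
  | cons a u ih =>
    rw [chain_cons, zero_add] at h
    have ih := ih h.2.zero
    have ha : (a : ℝ) ≤ 1 := by exact_mod_cast h.1
    have e1 : √5 * (valF (a :: u) : ℝ)
          - Real.goldenRatio ^ ((a :: u).length + 2) * relVal (a :: u) =
        a * (√5 * F u.length - Real.goldenRatio ^ (u.length + 2)) +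
          (√5 * valF u - Real.goldenRatio ^ (u.length + 2) * relVal u) := by
      rw [valF, relVal, List.length_cons, show u.length + 1 + 2 = u.length + 2 + 1 by ring,
        pow_succ _ (u.length + 2), mul_assoc, mul_div_cancel₀ _ h2.ne']
      push_cast
      ring
    have h4 : (0 : ℝ) ≤ (Real.goldenRatio - 1) ^ (u.length + 2) := pow_nonneg (by linarith) _
    rw [e1]
    refine (abs_add_le _ _).trans ?_
    rw [abs_mul, abs_sqrt_five_mul_F_sub, Nat.abs_cast, List.length_cons]
    have h5 : (Real.goldenRatio - 1) ^ (u.length + 2) =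
        (Real.goldenRatio - 1) ^ u.length - (Real.goldenRatio - 1) ^ (u.length + 1) := by
      rw [pow_add, pow_add]
      linear_combination (Real.goldenRatio - 1) ^ u.length * h3
    have h6 := mul_le_of_le_one_left h4 ha
    linarith

theorem relVal_w_add_two (n : ℕ) (α : ℝ) :
    relVal (w (n + 2) α) = (1 + relVal ((List.range n).map (phiDigit α)) / Real.goldenRatio) /
      Real.goldenRatio := by
  rw [w_add_two, relVal, relVal]
  push_cast
  rw [zero_add]

theorem relVal_phiDigit_mem {α : ℝ} (hα : α ∈ Ico (0 : ℝ) 1) (n : ℕ) :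
    α - 1 / Real.goldenRatio ^ n ≤ relVal ((List.range n).map (phiDigit α)) ∧
      relVal ((List.range n).map (phiDigit α)) ≤ α := by
  have h2 := Real.goldenRatio_pos
  have hs := hasSum_phiDigit hα
  have ht := ((isPhiExpansion_iff hα _).2 rfl).2 n
  rw [relVal_map_range]
  constructor
  · have h3 := hs.summable.sum_add_tsum_nat_add n
    rw [hs.tsum_eq] at h3
    simp only [add_comm n] at ht
    linarith
  · exact sum_le_hasSum _ (fun i _ => by positivity) hs

/-- `e_n(α)` is an affine function of `α`, up to a bounded error. -/
theorem abs_sqrt_five_mul_e_sub {α : ℝ} (hα : α ∈ Ico (0 : ℝ) 1) (n : ℕ) :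
    |√5 * e (n + 2) α - Real.goldenRatio ^ (n + 2) * (Real.goldenRatio + α)| ≤ 4 := by
  have h2 := Real.goldenRatio_pos
  have h3 := Real.goldenRatio_sq
  have h4 := Real.goldenRatio_lt_two
  have hch : Chain 0 (w (n + 2) α) := chain_map_range (phiWord_add_succ_le hα) (by simp [phiWord]) _
  have h5 := abs_sqrt_five_mul_valF_sub hch
  have h6 : (0 : ℝ) ≤ (Real.goldenRatio - 1) ^ (w (n + 2) α).length :=
    pow_nonneg (by linarith [Real.one_lt_goldenRatio]) _
  obtain ⟨h7, h8⟩ := relVal_phiDigit_mem hα n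
  set x := relVal ((List.range n).map (phiDigit α)) with hx
  have hl : (w (n + 2) α).length = n + 2 := by simp [w]
  have e1 : Real.goldenRatio ^ ((w (n + 2) α).length + 2) * relVal (w (n + 2) α) =
      Real.goldenRatio ^ (n + 2) * (Real.goldenRatio + x) := by
    rw [hl, relVal_w_add_two, ← hx, pow_add _ (n + 2)]
    field_simp
  rw [e1, ← e] at h5
  have e2 : Real.goldenRatio ^ (n + 2) * (α - x) ≤ 3 := by
    calc _ ≤ Real.goldenRatio ^ (n + 2) * (1 / Real.goldenRatio ^ n) := by gcongr; linarith
      _ = Real.goldenRatio ^ 2 := by rw [pow_add]; field_simp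
      _ ≤ 3 := by linarith
  have e3 : 0 ≤ Real.goldenRatio ^ (n + 2) * (α - x) :=
    mul_nonneg (by positivity) (by linarith)
  rw [abs_le] at h5 ⊢
  constructor <;> linarith [h5.1, h5.2]

theorem abs_e_sub_e_le {α α' : ℝ} (hα : α ∈ Ico (0 : ℝ) 1) (hα' : α' ∈ Ico (0 : ℝ) 1) (n : ℕ) :
    |(e (n + 2) α : ℝ) - e (n + 2) α'| ≤ 8 + Real.goldenRatio ^ (n + 2) * |α - α'| := by
  have h1 := abs_sqrt_five_mul_e_sub hα n
  have h2 := abs_sqrt_five_mul_e_sub hα' n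
  have h3 : (1 : ℝ) ≤ √5 := Real.one_le_sqrt.2 (by norm_num)
  have h4 := Real.goldenRatio_pos
  set p := Real.goldenRatio ^ (n + 2) with hp
  have h5 : |√5 * ((e (n + 2) α : ℝ) - e (n + 2) α')| ≤ 8 + p * |α - α'| := by
    have e1 : √5 * ((e (n + 2) α : ℝ) - e (n + 2) α') =
        (√5 * e (n + 2) α - p * (Real.goldenRatio + α))
          - (√5 * e (n + 2) α' - p * (Real.goldenRatio + α')) + p * (α - α') := by ring
    rw [e1]
    refine (abs_add_le _ _).trans ?_
    rw [abs_mul p, abs_of_pos (show 0 < p by positivity)]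
    linarith [abs_sub (√5 * e (n + 2) α - p * (Real.goldenRatio + α))
      (√5 * e (n + 2) α' - p * (Real.goldenRatio + α'))]
  rw [abs_mul, abs_of_pos (by linarith)] at h5
  nlinarith [abs_nonneg ((e (n + 2) α : ℝ) - e (n + 2) α')]

/-- For `α` close to `1`, the number `e_n(α)` is close to `F n`. -/
theorem abs_F_sub_e_le {α : ℝ} (hα : α ∈ Ico (0 : ℝ) 1) (n : ℕ) :
    |(F (n + 2) : ℝ) - e (n + 2) α| ≤ 5 + Real.goldenRatio ^ (n + 2) * |1 - α| := by
  have h1 := abs_sqrt_five_mul_e_sub hα n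
  have h2 := abs_sqrt_five_mul_F_sub (n + 2)
  have h3 : (1 : ℝ) ≤ √5 := Real.one_le_sqrt.2 (by norm_num)
  have h4 := Real.goldenRatio_pos
  have h6 := Real.goldenRatio_sq
  have h7 : (Real.goldenRatio - 1) ^ (n + 2 + 2) ≤ 1 :=
    pow_le_one₀ (by linarith [Real.one_lt_goldenRatio]) (by linarith [Real.goldenRatio_lt_two])
  rw [pow_add _ (n + 2) 2, h6] at h2
  set p := Real.goldenRatio ^ (n + 2) with hp
  have h5 : |√5 * ((F (n + 2) : ℝ) - e (n + 2) α)| ≤ 5 + p * |1 - α| := by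
    have e1 : √5 * ((F (n + 2) : ℝ) - e (n + 2) α) =
        (√5 * F (n + 2) - p * (Real.goldenRatio + 1))
          - (√5 * e (n + 2) α - p * (Real.goldenRatio + α)) + p * (1 - α) := by ring
    rw [e1]
    refine (abs_add_le _ _).trans ?_
    rw [abs_mul p, abs_of_pos (show 0 < p by positivity)]
    linarith [abs_sub (√5 * F (n + 2) - p * (Real.goldenRatio + 1))
      (√5 * e (n + 2) α - p * (Real.goldenRatio + α))]
  rw [abs_mul, abs_of_pos (by linarith)] at h5
  nlinarith [abs_nonneg ((F (n + 2) : ℝ) - e (n + 2) α)]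

theorem relposF_eq_relVal {n : ℕ} {u : List ℕ} (h : repF n = 1 :: 0 :: u) :
    relposF n = relVal u := by
  rw [relposF, h, relVal_eq_sum]
  rfl

theorem logF_eq {n : ℕ} (h : n ≠ 0) : logF n = ellF n + relposF n := by
  obtain ⟨u, h1, -, h2, -⟩ := repF_eq_cons h
  rw [logF, ← h2, h1]
  simp

theorem logF_e {α : ℝ} (hα : α ∈ Ico (0 : ℝ) 1) (n : ℕ) :
    logF (e (n + 2) α) = n + 1 + relVal ((List.range n).map (phiDigit α)) := by
  have h1 := (repF_e hα (n + 1)).trans (w_add_two n α)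
  rw [logF, relposF_eq_relVal h1, h1]
  simp

/-- Every `N ≥ 3` is one of the numbers `e_n(α)`, namely for `α` its own relative position. -/
theorem relposF_mem_and_e_relposF {N : ℕ} (hN : 3 ≤ N) :
    relposF N ∈ Ico (0 : ℝ) 1 ∧ e (ellF N + 1) (relposF N) = N := by
  obtain ⟨u, h1, h2, h3, h4⟩ := repF_eq_cons (show N ≠ 0 by omega)
  obtain ⟨m, rfl⟩ := Nat.exists_eq_add_of_le' hN
  have h5 := two_le_ellF m
  rcases chain_one_iff.1 h2 with rfl | ⟨v, rfl, hv⟩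
  · simp at h3; omega
  rw [relposF_eq_relVal h1, ← h3, List.length_cons]
  refine ⟨⟨relVal_nonneg v, relVal_lt_one hv⟩, ?_⟩
  rw [e, w_add_two]
  have h6 : (List.range v.length).map (phiDigit (relVal v)) = v := by
    refine List.ext_getElem (by simp) fun i hi hi' => ?_
    simp [phiDigit_relVal hv, hi']
  rw [h6, h4]

/-! ### Asymptotics of `AF` along `e_n(α)` -/

/-- The series `∑ b_i(α) / β ^ i`, that is, `Ψ(α)` without the factor `β ^ (-α)`. -/
noncomputable def bSeries (β α : ℝ) : ℝ := ∑' i, (bLim α i : ℝ) / β ^ i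

theorem Psi_eq (β α : ℝ) : Psi β α = 1 / β ^ α * bSeries β α := rfl

theorem AF_F_sub_one (k : ℕ) : (AF (F k - 1) : ℤ) = B k := by
  rw [AF, Nat.sub_add_cancel (F_pos k), sum_sF_range_F]

theorem e_zero (k : ℕ) : e (k + 2) 0 = F (k + 1) := by
  have h0 : ∀ i, phiDigit 0 i = 0 := fun i => by
    simpa [relVal] using phiDigit_relVal (u := []) (by simp) i
  have h : ∀ n, prefixVal (fun _ => 0) n = 0 := by
    intro n
    induction n with
    | zero => rfl
    | succ n ih => rw [prefixVal_succ, ih, zero_mul]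
  rw [e_eq_prefixVal, prefixVal_succ, prefixVal_succ]
  simp [phiWord, h0, h]

theorem norm_bLim_div_le {β α : ℝ} (hβ : 0 < β) (hα : α ∈ Ico (0 : ℝ) 1) (i : ℕ) :
    ‖(bLim α i : ℝ) / β ^ i‖ ≤ 4 * (2 / β) ^ i := by
  rw [Real.norm_eq_abs, abs_div, abs_of_pos (pow_pos hβ i), div_pow, mul_div_assoc']
  gcongr
  exact abs_bLim_le hα i

theorem summable_bLim {β α : ℝ} (hβ : 2 < β) (hα : α ∈ Ico (0 : ℝ) 1) :
    Summable fun i => (bLim α i : ℝ) / β ^ i := by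
  have hq : 2 / β < 1 := (div_lt_one (by linarith)).2 hβ
  exact .of_norm_bounded ((summable_geometric_of_lt_one (by positivity) hq).mul_left 4)
    (norm_bLim_div_le (by linarith) hα)

theorem abs_bSeries_sub_sum_le {β α : ℝ} (hβ : 2 < β) (hα : α ∈ Ico (0 : ℝ) 1) (k : ℕ) :
    |bSeries β α - ∑ i ∈ Finset.range k, (bLim α i : ℝ) / β ^ i| ≤
      4 / (1 - 2 / β) * (2 / β) ^ k := by
  have hq : 2 / β < 1 := (div_lt_one (by linarith)).2 hβ
  rw [bSeries, ← (summable_bLim hβ hα).sum_add_tsum_nat_add k, add_sub_cancel_left,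
    ← Real.norm_eq_abs]
  refine tsum_of_norm_bounded (g := fun i => 4 * (2 / β) ^ k * (2 / β) ^ i) ?_ fun i => ?_
  · rw [div_mul_eq_mul_div, div_eq_mul_inv]
    exact (hasSum_geometric_of_lt_one (by positivity) hq).mul_left _
  · refine (norm_bLim_div_le (by linarith) hα (i + k)).trans_eq ?_
    rw [pow_add]
    ring

/-- The key estimate: `AF (e_n(α))` equals its main term up to `O(2 ^ n)`, uniformly in `α`. -/
theorem exists_abs_AF_e_sub_le {β c M : ℝ} (hβ : 2 < β) (hc : 0 < c)
    (hB : ∀ n, |(B n : ℝ) - c * β ^ n| ≤ M) :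
    ∃ K : ℝ, ∀ α ∈ Ico (0 : ℝ) 1, ∀ k : ℕ,
      |(AF (e (k + 2) α) : ℝ) - c * β ^ (k + 1) * bSeries β α| ≤ K * 2 ^ k := by
  have hβ0 : 0 < β := by linarith
  have hq : 2 / β < 1 := (div_lt_one hβ0).2 hβ
  have hM : 0 ≤ M := (abs_nonneg _).trans (hB 0)
  refine ⟨16 * M + c * β * (4 / (1 - 2 / β) + 8), fun α hα k => ?_⟩
  set m := e (k + 2) α with hm
  have hl : ellF m = k + 1 := ellF_e hα (k + 1)
  have hb : ∀ i, |(bCoeff m i : ℝ)| ≤ 4 * 2 ^ i := fun i => by exact_mod_cast abs_bCoeff_le m i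
  -- replacing `B n` by `c β ^ n`
  have h1 : |(AF m : ℝ) - c * β ^ (k + 1) * ∑ i ∈ Finset.range (k + 2), (bCoeff m i : ℝ) / β ^ i| ≤
      16 * M * 2 ^ k := by
    have e1 : (AF m : ℝ) = ∑ i ∈ Finset.range (k + 2), (bCoeff m i : ℝ) * B (k + 1 - i) := by
      have := AF_eq_sum_bCoeff m
      rw [hl] at this
      exact_mod_cast this
    have e2 : (AF m : ℝ) - c * β ^ (k + 1) * ∑ i ∈ Finset.range (k + 2), (bCoeff m i : ℝ) / β ^ i =
        ∑ i ∈ Finset.range (k + 2), (bCoeff m i : ℝ) * (B (k + 1 - i) - c * β ^ (k + 1 - i)) := by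
      rw [e1, Finset.mul_sum, ← Finset.sum_sub_distrib]
      refine Finset.sum_congr rfl fun i hi => ?_
      have hi : i ≤ k + 1 := by have := Finset.mem_range.1 hi; omega
      rw [pow_sub₀ _ hβ0.ne' hi]
      ring
    rw [e2]
    calc _ ≤ ∑ i ∈ Finset.range (k + 2),
          |(bCoeff m i : ℝ) * (B (k + 1 - i) - c * β ^ (k + 1 - i))| :=
        Finset.abs_sum_le_sum_abs _ _
      _ ≤ ∑ i ∈ Finset.range (k + 2), 4 * 2 ^ i * M := by
          refine Finset.sum_le_sum fun i _ => ?_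
          rw [abs_mul]
          exact mul_le_mul (hb i) (hB _) (abs_nonneg _) (by positivity)
      _ = 4 * M * (2 ^ (k + 2) - 1) := by
          rw [← Finset.sum_mul, ← Finset.mul_sum, geom_sum_eq (by norm_num)]
          ring
      _ ≤ _ := by rw [pow_add]; nlinarith
  -- replacing the coefficients by their limits; only the last two can differ
  have h2 : |∑ i ∈ Finset.range (k + 2), (bCoeff m i : ℝ) / β ^ i - bSeries β α| ≤
      (4 / (1 - 2 / β) + 8) * (2 / β) ^ k := by
    have e1 : ∑ i ∈ Finset.range k, (bCoeff m i : ℝ) / β ^ i =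
        ∑ i ∈ Finset.range k, (bLim α i : ℝ) / β ^ i := by
      refine Finset.sum_congr rfl fun i hi => ?_
      have := Finset.mem_range.1 hi
      rw [hm, bCoeff_e hα (by omega)]
    have h3 := abs_bSeries_sub_sum_le hβ hα k
    have h4 : ∀ i, |(bCoeff m i : ℝ) / β ^ i| ≤ 4 * (2 / β) ^ i := by
      intro i
      rw [abs_div, abs_of_pos (pow_pos hβ0 i), div_pow, mul_div_assoc']
      gcongr
      exact hb i
    have h5 := h4 k
    have h6 : |(bCoeff m (k + 1) : ℝ) / β ^ (k + 1)| ≤ 4 * (2 / β) ^ k :=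
      (h4 (k + 1)).trans (by
        gcongr 4 * ?_
        exact pow_le_pow_of_le_one (by positivity) hq.le (by omega))
    rw [Finset.sum_range_succ, Finset.sum_range_succ, e1]
    rw [abs_le] at *
    constructor <;> linarith
  have h3 : |c * β ^ (k + 1) * ∑ i ∈ Finset.range (k + 2), (bCoeff m i : ℝ) / β ^ i -
      c * β ^ (k + 1) * bSeries β α| ≤ c * β * (4 / (1 - 2 / β) + 8) * 2 ^ k := by
    rw [← mul_sub, abs_mul, abs_of_pos (show 0 < c * β ^ (k + 1) by positivity)]
    calc _ ≤ c * β ^ (k + 1) * ((4 / (1 - 2 / β) + 8) * (2 / β) ^ k) := by gcongr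
      _ = _ := by rw [div_pow, pow_succ]; field_simp
  calc _ ≤ _ := abs_sub_le _ _ _
    _ ≤ _ := add_le_add h1 h3
    _ = _ := by ring

/-! ### Continuity of the limit function -/

theorem abs_le_of_mul_le {β c x K : ℝ} (hβ : 0 < β) (hc : 0 < c) {k : ℕ}
    (h : |c * β ^ (k + 1) * x| ≤ K * 2 ^ k) : |x| ≤ K / (c * β) * (2 / β) ^ k := by
  rw [abs_mul, abs_of_pos (show 0 < c * β ^ (k + 1) by positivity), mul_comm,
    ← le_div_iff₀ (by positivity)] at h
  refine h.trans_eq ?_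
  rw [div_pow, pow_succ]
  field_simp

theorem tendsto_const_mul_two_div_pow {β : ℝ} (hβ : 2 < β) (K : ℝ) :
    Tendsto (fun k : ℕ => K * (2 / β) ^ k) atTop (𝓝 0) := by
  simpa using (tendsto_pow_atTop_nhds_zero_of_lt_one (r := 2 / β) (by positivity)
    ((div_lt_one (by linarith)).2 hβ)).const_mul K

/-- Since `e_n` is almost affine and `AF` has small increments, nearby points have nearby values. -/
theorem continuousOn_bSeries {β c M : ℝ} (hβ : 2 < β) (hc : 0 < c)
    (hB : ∀ n, |(B n : ℝ) - c * β ^ n| ≤ M) : ContinuousOn (bSeries β) (Ico 0 1) := by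
  obtain ⟨K, hK⟩ := exists_abs_AF_e_sub_le hβ hc hB
  have key : ∀ k : ℕ, ∀ α ∈ Ico (0 : ℝ) 1, ∀ α' ∈ Ico (0 : ℝ) 1,
      Real.goldenRatio ^ (k + 2) * |α - α'| ≤ 1 →
        |bSeries β α - bSeries β α'| ≤ (2 * K + 36) / (c * β) * (2 / β) ^ k := by
    intro k α hα α' hα' h
    refine abs_le_of_mul_le (by linarith) hc ?_
    have h1 := hK α hα k
    have h2 := hK α' hα' k
    have h3 := abs_AF_sub_le (e_lt hα (k + 2)) (e_lt hα' (k + 2))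
    have h4 := abs_e_sub_e_le hα hα' k
    have h5 : |(AF (e (k + 2) α) : ℝ) - AF (e (k + 2) α')| ≤ 36 * 2 ^ k := by
      calc _ ≤ _ := h3
        _ ≤ 9 * 2 ^ (k + 2) := by gcongr; linarith
        _ = _ := by ring
    rw [mul_sub]
    rw [abs_le] at *
    constructor <;> linarith
  rw [Metric.continuousOn_iff]
  intro α hα ε hε
  obtain ⟨k, hk⟩ := ((tendsto_const_mul_two_div_pow hβ _).eventually_lt_const hε).exists
  have hp : 0 < Real.goldenRatio ^ (k + 2) := pow_pos Real.goldenRatio_pos _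
  refine ⟨1 / Real.goldenRatio ^ (k + 2), by positivity, fun α' hα' h => ?_⟩
  rw [Real.dist_eq, lt_div_iff₀ hp, mul_comm] at h
  exact (key k α' hα' α hα h.le).trans_lt hk

theorem bSeries_zero {β c M : ℝ} (hβ : 2 < β) (hc : 0 < c)
    (hB : ∀ n, |(B n : ℝ) - c * β ^ n| ≤ M) : bSeries β 0 = 1 := by
  obtain ⟨K, hK⟩ := exists_abs_AF_e_sub_le hβ hc hB
  have hM : 0 ≤ M := (abs_nonneg _).trans (hB 0)
  have h0 : (0 : ℝ) ∈ Ico (0 : ℝ) 1 := by simp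
  have key : ∀ k : ℕ, |bSeries β 0 - 1| ≤ (K + 4 + M) / (c * β) * (2 / β) ^ k := by
    intro k
    refine abs_le_of_mul_le (by linarith) hc ?_
    have h1 := hK 0 h0 k
    rw [e_zero] at h1
    have h2 := hB (k + 1)
    have h3 : F (k + 1) < F (k + 2) := F_lt (l := k + 2) (by omega)
    have h4 := abs_AF_sub_le h3 (show F (k + 1) - 1 < F (k + 2) by omega)
    have h5 : (AF (F (k + 1) - 1) : ℝ) = B (k + 1) := by exact_mod_cast AF_F_sub_one (k + 1)
    rw [h5, Nat.cast_pred (F_pos _), sub_sub_cancel, abs_one, one_mul, pow_add] at h4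
    have h6 : M ≤ M * 2 ^ k := le_mul_of_one_le_right hM (one_le_pow₀ (by norm_num))
    rw [mul_sub]
    rw [abs_le] at *
    constructor <;> linarith
  have h1 := ge_of_tendsto' (tendsto_const_mul_two_div_pow hβ _) key
  exact sub_eq_zero.1 (abs_nonpos_iff.1 h1)

theorem tendsto_bSeries_one {β c M : ℝ} (hβ : 2 < β) (hc : 0 < c)
    (hB : ∀ n, |(B n : ℝ) - c * β ^ n| ≤ M) : Tendsto (bSeries β) (𝓝[<] 1) (𝓝 β) := by
  obtain ⟨K, hK⟩ := exists_abs_AF_e_sub_le hβ hc hB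
  have hM : 0 ≤ M := (abs_nonneg _).trans (hB 0)
  have key : ∀ k : ℕ, ∀ α ∈ Ico (0 : ℝ) 1, Real.goldenRatio ^ (k + 2) * |1 - α| ≤ 1 →
      |bSeries β α - β| ≤ (K + 28 + M) / (c * β) * (2 / β) ^ k := by
    intro k α hα h
    refine abs_le_of_mul_le (by linarith) hc ?_
    have h1 := hK α hα k
    have h2 := hB (k + 2)
    have hF := F_pos (k + 2)
    have h3 := abs_AF_sub_le (e_lt hα (k + 2)) (show F (k + 2) - 1 < F (k + 2) by omega)
    have h4 := abs_F_sub_e_le hα k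
    have h5 : (AF (F (k + 2) - 1) : ℝ) = B (k + 2) := by exact_mod_cast AF_F_sub_one (k + 2)
    have h6 : M ≤ M * 2 ^ k := le_mul_of_one_le_right hM (one_le_pow₀ (by norm_num))
    have h7 : |(AF (e (k + 2) α) : ℝ) - B (k + 2)| ≤ 28 * 2 ^ k := by
      rw [h5, Nat.cast_pred hF] at h3
      calc _ ≤ _ := h3
        _ ≤ 7 * 2 ^ (k + 2) := by
            gcongr
            rw [abs_le] at *
            constructor <;> linarith
        _ = _ := by ring
    have e1 : c * β ^ (k + 1) * (bSeries β α - β) =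
        c * β ^ (k + 1) * bSeries β α - c * β ^ (k + 2) := by ring
    rw [e1]
    rw [abs_le] at *
    constructor <;> linarith
  rw [Metric.tendsto_nhdsWithin_nhds]
  intro ε hε
  obtain ⟨k, hk⟩ := ((tendsto_const_mul_two_div_pow hβ
    ((K + 28 + M) / (c * β))).eventually_lt_const hε).exists
  have hp : 1 ≤ Real.goldenRatio ^ (k + 2) := one_le_pow₀ Real.one_lt_goldenRatio.le
  refine ⟨1 / Real.goldenRatio ^ (k + 2), by positivity, fun {α} hα h => ?_⟩
  have hα1 : α < 1 := hα
  rw [Real.dist_eq, abs_sub_comm, lt_div_iff₀ (by linarith), mul_comm] at h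
  have hα0 : 0 ≤ α := by
    rw [abs_of_pos (by linarith)] at h
    nlinarith
  exact (key k α ⟨hα0, hα1⟩ h.le).trans_lt hk

/-! ### The limit function `Ψ` -/

theorem continuousOn_Psi {β c M : ℝ} (hβ : 2 < β) (hc : 0 < c)
    (hB : ∀ n, |(B n : ℝ) - c * β ^ n| ≤ M) : ContinuousOn (Psi β) (Ico 0 1) := by
  have hβ0 : 0 < β := by linarith
  refine ContinuousOn.mul (Continuous.continuousOn ?_) (continuousOn_bSeries hβ hc hB)
  exact continuous_const.div (Real.continuous_const_rpow hβ0.ne')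
    fun α => (Real.rpow_pos_of_pos hβ0 α).ne'

theorem Psi_zero {β c M : ℝ} (hβ : 2 < β) (hc : 0 < c)
    (hB : ∀ n, |(B n : ℝ) - c * β ^ n| ≤ M) : Psi β 0 = 1 := by
  rw [Psi_eq, bSeries_zero hβ hc hB, Real.rpow_zero, div_one, mul_one]

theorem tendsto_Psi_one {β c M : ℝ} (hβ : 2 < β) (hc : 0 < c)
    (hB : ∀ n, |(B n : ℝ) - c * β ^ n| ≤ M) : Tendsto (Psi β) (𝓝[<] 1) (𝓝 1) := by
  have hβ0 : 0 < β := by linarith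
  have h1 : Tendsto (fun α : ℝ => 1 / β ^ α) (𝓝[<] 1) (𝓝 (1 / β ^ (1 : ℝ))) :=
    ((continuous_const.div (Real.continuous_const_rpow hβ0.ne')
      fun α => (Real.rpow_pos_of_pos hβ0 α).ne').tendsto 1).mono_left nhdsWithin_le_nhds
  have h2 := h1.mul (tendsto_bSeries_one hβ hc hB)
  rwa [Real.rpow_one, one_div_mul_cancel hβ0.ne'] at h2

theorem tendstoUniformlyOn_psi {β c M : ℝ} (hβ : 2 < β) (hc : 0 < c)
    (hB : ∀ n, |(B n : ℝ) - c * β ^ n| ≤ M) :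
    TendstoUniformlyOn (psi β c) (Psi β) atTop (Ico 0 1) := by
  have hβ0 : 0 < β := by linarith
  have hφ := Real.goldenRatio_pos
  obtain ⟨K, hK⟩ := exists_abs_AF_e_sub_le hβ hc hB
  set S : ℝ := 4 / (1 - 2 / β) with hS
  set δ : ℕ → ℝ := fun k =>
    K / (c * β) * (2 / β) ^ k + S * (β ^ (1 / Real.goldenRatio ^ k) - 1) with hδ
  have key : ∀ k : ℕ, ∀ α ∈ Ico (0 : ℝ) 1, |psi β c (k + 2) α - Psi β α| ≤ δ k := by
    intro k α hα
    obtain ⟨hx1, hx2⟩ := relVal_phiDigit_mem hα k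
    have hlog := logF_e hα k
    have hx0 := relVal_nonneg ((List.range k).map (phiDigit α))
    set x := relVal ((List.range k).map (phiDigit α)) with hx
    set T := bSeries β α with hT
    have hT0 : |T| ≤ S := by simpa using abs_bSeries_sub_sum_le hβ hα 0
    have h1 : |(AF (e (k + 2) α) : ℝ) / (c * β ^ (k + 1)) - T| ≤ K / (c * β) * (2 / β) ^ k := by
      refine abs_le_of_mul_le hβ0 hc ?_
      rw [mul_sub, mul_div_cancel₀ _ (by positivity)]
      exact hK α hα k
    have h2 : psi β c (k + 2) α = 1 / β ^ x * ((AF (e (k + 2) α) : ℝ) / (c * β ^ (k + 1))) := by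
      have : β ^ logF (e (k + 2) α) = β ^ (k + 1) * β ^ x := by
        rw [hlog, Real.rpow_add hβ0]
        congr 1
        exact_mod_cast Real.rpow_natCast β (k + 1)
      rw [psi, this]
      field_simp
    have h3 : 1 / β ^ x ≤ 1 := by
      rw [div_le_one (by positivity)]
      exact Real.one_le_rpow (by linarith) hx0
    have h4 : 1 / β ^ x - 1 / β ^ α = 1 / β ^ α * (β ^ (α - x) - 1) := by
      rw [Real.rpow_sub hβ0]
      field_simp
    have h5 : 1 ≤ β ^ (α - x) := Real.one_le_rpow (by linarith) (by linarith)
    have h6 : β ^ (α - x) ≤ β ^ (1 / Real.goldenRatio ^ k) :=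
      Real.rpow_le_rpow_of_exponent_le (by linarith) (by linarith)
    have h7 : 1 / β ^ α ≤ 1 := by
      rw [div_le_one (by positivity)]
      exact Real.one_le_rpow (by linarith) hα.1
    have h8 : 0 < 1 / β ^ x := by positivity
    have h9 : 0 < 1 / β ^ α := by positivity
    have e1 : psi β c (k + 2) α - Psi β α =
        1 / β ^ x * ((AF (e (k + 2) α) : ℝ) / (c * β ^ (k + 1)) - T)
          + T * (1 / β ^ α * (β ^ (α - x) - 1)) := by
      rw [h2, Psi_eq, ← h4]
      ring
    rw [e1]
    refine (abs_add_le _ _).trans (add_le_add ?_ ?_)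
    · rw [abs_mul, abs_of_pos h8]
      exact (mul_le_of_le_one_left (abs_nonneg _) h3).trans h1
    · rw [abs_mul, abs_of_nonneg (mul_nonneg h9.le (by linarith))]
      refine mul_le_mul hT0 ?_ (mul_nonneg h9.le (by linarith)) ((abs_nonneg _).trans hT0)
      exact (mul_le_of_le_one_left (by linarith) h7).trans (by linarith)
  have hδ0 : Tendsto δ atTop (𝓝 0) := by
    have h1 : Tendsto (fun k : ℕ => 1 / Real.goldenRatio ^ k) atTop (𝓝 0) := by
      simp only [one_div]
      exact (tendsto_pow_atTop_atTop_of_one_lt Real.one_lt_goldenRatio).inv_tendsto_atTop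
    have h2 := ((Real.continuous_const_rpow hβ0.ne').tendsto 0).comp h1
    have h3 := (tendsto_const_mul_two_div_pow hβ (K / (c * β))).add
      ((h2.sub_const 1).const_mul S)
    simpa [hδ] using h3
  rw [Metric.tendstoUniformlyOn_iff]
  intro ε hε
  obtain ⟨k₀, hk₀⟩ := eventually_atTop.1 (hδ0.eventually_lt_const hε)
  filter_upwards [eventually_ge_atTop (k₀ + 2)] with n hn α hα
  obtain ⟨k, rfl⟩ := Nat.exists_eq_add_of_le' (show 2 ≤ n by omega)
  rw [dist_comm, Real.dist_eq]
  exact (key k α hα).trans_lt (hk₀ k (by omega))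

theorem tendsto_ellF : Tendsto ellF atTop atTop := by
  rw [tendsto_atTop]
  intro L
  filter_upwards [eventually_ge_atTop (F L)] with N hN
  by_contra! h
  have := lt_F_ellF_add_one N
  have := F_mono (show ellF N + 1 ≤ L from h)
  omega

theorem floor_logF {N : ℕ} (hN : 3 ≤ N) : ⌊logF N⌋ = ellF N := by
  have h := (relposF_mem_and_e_relposF hN).1
  rw [logF_eq (by omega), Int.floor_eq_iff]
  push_cast
  exact ⟨by linarith [h.1], by linarith [h.2]⟩

theorem AF_sub_isLittleO {β c M : ℝ} (hβ : 2 < β) (hc : 0 < c)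
    (hB : ∀ n, |(B n : ℝ) - c * β ^ n| ≤ M) :
    (fun N : ℕ => (AF N : ℝ) - c * β ^ logF N * Psi β (relposF N)) =o[atTop]
      fun N : ℕ => β ^ ⌊logF N⌋ := by
  have hβ0 : 0 < β := by linarith
  obtain ⟨K, hK⟩ := exists_abs_AF_e_sub_le hβ hc hB
  have hK0 : 0 ≤ K := by simpa using (abs_nonneg _).trans (hK 0 (by simp) 0)
  rw [Asymptotics.isLittleO_iff]
  intro ε hε
  filter_upwards [((tendsto_const_mul_two_div_pow hβ K).comp tendsto_ellF).eventually_lt_const hε,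
    eventually_ge_atTop 3] with N hN hN3
  simp only [Function.comp_apply] at hN
  obtain ⟨hα, he⟩ := relposF_mem_and_e_relposF hN3
  rw [floor_logF hN3, zpow_natCast, logF_eq (by omega), Psi_eq]
  have hl : 2 ≤ ellF N := by
    obtain ⟨m, rfl⟩ := Nat.exists_eq_add_of_le' hN3
    exact two_le_ellF m
  obtain ⟨k, hk⟩ := Nat.exists_eq_add_of_le' (show 1 ≤ ellF N by omega)
  have h1 := hK _ hα k
  rw [← show ellF N + 1 = k + 2 by omega, he, ← hk] at h1
  have e1 : c * β ^ ((ellF N : ℝ) + relposF N) * (1 / β ^ relposF N * bSeries β (relposF N)) =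
      c * β ^ ellF N * bSeries β (relposF N) := by
    rw [Real.rpow_add hβ0, Real.rpow_natCast]
    field_simp
  rw [e1, Real.norm_eq_abs, Real.norm_eq_abs, abs_of_pos (show 0 < β ^ ellF N by positivity)]
  calc _ ≤ K * 2 ^ k := h1
    _ ≤ K * 2 ^ ellF N := by gcongr <;> [norm_num; omega]
    _ = K * (2 / β) ^ ellF N * β ^ ellF N := by rw [div_pow]; field_simp
    _ ≤ ε * β ^ ellF N := by gcongr

end FibSubwords

open FibSubwords
theorem theorem4 :
    ∃ β β₂ β₃ c c₂ c₃ : ℝ,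
      -- `β` is the dominant root of `X³ - 2X² - X + 1`
      (X ^ 3 - 2 * X ^ 2 - X + 1 : ℝ[X]) = (X - C β) * (X - C β₂) * (X - C β₃) ∧
      |β₂| < β ∧ |β₃| < β ∧
      -- `c` is the coefficient of `β ^ n` in the closed form of `B n`
      (∀ n : ℕ, (B n : ℝ) = c * β ^ n + c₂ * β₂ ^ n + c₃ * β₃ ^ n) ∧ 0 < c ∧
      -- `Ψ` is well defined on `[0, 1)`: the limits and the series in its definition exist
      (∀ α ∈ Ico (0 : ℝ) 1,
        (∀ i : ℕ, ∀ᶠ n in atTop, bCoeff (e n α) i = bLim α i) ∧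
        Summable fun i : ℕ => (bLim α i : ℝ) / β ^ i) ∧
      -- `Ψ` is the uniform limit of the step functions `ψ_n`
      TendstoUniformlyOn (psi β c) (Psi β) atTop (Ico (0 : ℝ) 1) ∧
      ContinuousOn (Psi β) (Ico (0 : ℝ) 1) ∧
      Psi β 0 = 1 ∧
      Tendsto (Psi β) (𝓝[<] (1 : ℝ)) (𝓝 1) ∧
      ∃ R : ℕ → ℝ,
        (∀ N : ℕ, 3 ≤ N → (AF N : ℝ) = c * β ^ logF N * Psi β (relposF N) + R N) ∧
        R =o[atTop] fun N : ℕ => β ^ ⌊logF N⌋ := by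
  obtain ⟨β, β₂, β₃, ⟨h1, h1'⟩, ⟨h2, h2'⟩, ⟨h3, h3'⟩, s1, s2, s3⟩ := exists_roots
  have hβ : 2 < β := by linarith
  have hcf := B_closed_form (show β - β₂ ≠ 0 by linarith) (show β - β₃ ≠ 0 by linarith)
    (show β₂ - β₃ ≠ 0 by linarith) s1 s2 s3
  have hc : 0 < (6 - 3 * (β₂ + β₃) + β₂ * β₃) / ((β - β₂) * (β - β₃)) :=
    div_pos (by nlinarith) (mul_pos (by linarith) (by linarith))
  generalize (6 - 3 * (β₂ + β₃) + β₂ * β₃) / ((β - β₂) * (β - β₃)) = c at hcf hc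
  generalize (6 - 3 * (β + β₃) + β * β₃) / ((β₂ - β) * (β₂ - β₃)) = c₂ at hcf
  generalize (6 - 3 * (β + β₂) + β * β₂) / ((β₃ - β) * (β₃ - β₂)) = c₃ at hcf
  have a2 : |β₂| < 1 := abs_lt.2 ⟨by linarith, by linarith⟩
  have a3 : |β₃| < 1 := abs_lt.2 ⟨by linarith, by linarith⟩
  have hB : ∀ n, |(B n : ℝ) - c * β ^ n| ≤ |c₂| + |c₃| := by
    intro n
    rw [hcf n, add_assoc, add_sub_cancel_left]
    refine (abs_add_le _ _).trans (add_le_add ?_ ?_)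
    · rw [abs_mul, abs_pow]
      exact mul_le_of_le_one_right (abs_nonneg _) (pow_le_one₀ (abs_nonneg _) a2.le)
    · rw [abs_mul, abs_pow]
      exact mul_le_of_le_one_right (abs_nonneg _) (pow_le_one₀ (abs_nonneg _) a3.le)
  refine ⟨β, β₂, β₃, c, c₂, c₃, ?_, by linarith, by linarith, hcf, hc,
    fun α hα => ⟨fun i => (eventually_ge_atTop (i + 3)).mono fun n hn => bCoeff_e hα hn,
      summable_bLim hβ hα⟩,
    tendstoUniformlyOn_psi hβ hc hB, continuousOn_Psi hβ hc hB, Psi_zero hβ hc hB,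
    tendsto_Psi_one hβ hc hB, _, fun N _ => (add_sub_cancel _ _).symm, AF_sub_isLittleO hβ hc hB⟩
  have t1 := congrArg (C : ℝ → ℝ[X]) s1
  have t2 := congrArg (C : ℝ → ℝ[X]) s2
  have t3 := congrArg (C : ℝ → ℝ[X]) s3
  simp only [C_add, C_mul, C_neg, C_1, map_ofNat] at t1 t2 t3
  linear_combination X ^ 2 * t1 - X * t2 + t3
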